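/- **Language.** Fix a set $\mathsf{Prop}$ of propositional variables and an infinite set $\mathsf{Nom}$ of nominals. Formulas are built from variables $p$, nominals $\mathbf i$, $\bot,\top$ by $\neg,\wedge,\vee,\to,\Box,\Diamond$ and the black connectives $\blacklozenge,\blacksquare$ (all treated as primitive symbols); a formula is *basic* if it contains no nominals and no black connectives, and *pure* if it contains no propositional variables. An inequality is an expression $\varphi\le\psi$. **Signed trees.** The signed generation tree $+\varphi$ (resp. $-\varphi$) is the syntax tree of $\varphi$ with root signed $+$ (resp. $-$); a child has the sign of its parent, except that the child of $\neg$ and the first child of $\to$ have the opposite sign. An occurrence is positive (negative) in $\varphi$ if it is signed $+$ ($-$) in $+\varphi$; $\varphi$ is positive (negative) in $p$ if all occurrences of $p$ in $\varphi$ are. Nodes are classified as follows. $\Delta$-adjoint: $\pm\vee,\pm\wedge$. SLR: $+\wedge,+\Diamond,+\neg,-\vee,-\Box,-\neg,-\!\to$. SRA: $+\wedge,+\Box,+\neg,-\vee,-\Diamond,-\neg$. SRR: $+\vee,+\!\to,-\wedge$. Skeleton nodes are the $\Delta$-adjoint and SLR nodes; PIA nodes are the SRA and SRR nodes. **Inductive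 and Sahlqvist inequalities.** Let $\epsilon$ assign to every variable an order-type $1$ or $\partial$, and let $<_\Omega$ be an irreflexive and transitive relation on the variables. A leaf $+p$ with $\epsilon(p)=1$, or $-p$ with $\epsilon(p)=\partial$, is $\epsilon$-critical, and a branch to such a leaf is a critical branch. A signed tree is *$(\Omega,\epsilon)$-inductive* if every critical branch, with leaf variable $p$ say, consists, apart from its leaf, of a (possibly empty) part $P_2$ starting at the root, all of whose nodes are Skeleton nodes, followed by a (possibly empty) part $P_1$ down to the leaf, all of whose nodes are PIA nodes, such that for every SRR node in $P_1$ the subtree $\gamma$ at its child off the branch contains no $\epsilon$-critical leaf and $q<_\Omega p$ for every variable $q$ occurring in $\gamma$. It is *$\epsilon$-Sahlqvist* if every critical branch splits in this way with $P_1$ consisting of SRA nodes only. A basic inequality $\varphi\le\psi$ is $(\Omega,\epsilon)$-inductive (resp. $\epsilon$-Sahlqvist) if both $+\varphi$ and $-\psi$ are. **Algorithm, Stage 1.** Starting from the set $\{\varphi\le\psi\}$, the following rules are applied to members of the set until none is applicable. (1) Distribution, in $+\varphi$ or $-\psi$, at a node all of whose ancestors are Skeleton nodes: $+\Diamond$,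 $+\wedge$, $-\neg$ and $-\!\to$ are distributed over a child $+\vee$, and $-\Box$, $-\vee$, $+\neg$ and $-\!\to$ over a child $-\wedge$. (2) If $p$ occurs in $\alpha\le\beta$, with $\alpha$ negative and $\beta$ positive in $p$, replace $p$ by $\bot$; if $p$ occurs, with $\alpha$ positive and $\beta$ negative in $p$, replace $p$ by $\top$. (3) Splitting: $\alpha\le\beta\wedge\gamma$ becomes $\alpha\le\beta$, $\alpha\le\gamma$; and $\alpha\vee\beta\le\gamma$ becomes $\alpha\le\gamma$, $\beta\le\gamma$. **Algorithm, Stage 2.** For each resulting inequality $\varphi'\le\psi'$ one starts from the system $(\varnothing,\varphi'\le\psi')$ and rewrites systems $(S,\mathsf{Ineq})$, where $S$ is a set of inequalities, by these rules. *Approximation.* Let $\mathsf{Ineq}$ be $\varphi'\le\psi'$, and select an occurrence of a basic subformula $\gamma$ in the tree $+\varphi'$ or $-\psi'$ such that all nodes above $\gamma$ are SLR and the root of $\gamma$ is not an SLR node. For a nominal $\mathbf i$ occurring neither in $S$ nor in $\mathsf{Ineq}$: if $\gamma$ is signed $+$, replace the occurrence by $\mathbf i$ and add $\mathbf i\le\gamma$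 to $S$; if it is signed $-$, replace it by $\neg\mathbf i$ and add $\gamma\le\neg\mathbf i$ to $S$. *Residuation*, rewriting a member of $S$: $\Diamond\gamma\le\delta$ to $\gamma\le\blacksquare\delta$; $\neg\gamma\le\delta$ to $\neg\delta\le\gamma$; $\gamma\le\Box\delta$ to $\blacklozenge\gamma\le\delta$; $\gamma\le\neg\delta$ to $\delta\le\neg\gamma$; $\gamma\wedge\delta\le\beta$ to $\gamma\le\delta\to\beta$ or to $\delta\le\gamma\to\beta$; $\gamma\le\delta\vee\beta$ to $\gamma\wedge\neg\delta\le\beta$ or to $\gamma\wedge\neg\beta\le\delta$; $\gamma\le\delta\to\beta$ to $\gamma\wedge\delta\le\beta$ or to $\delta\le\gamma\to\beta$. *Splitting* of a member of $S$, as in (3). *Right Ackermann rule.* If $S=\{\alpha_i\le p\}_{i=1}^n\cup\{\beta_j\le\gamma_j\}_j$, where $p$ occurs neither in the $\alpha_i$ nor in $\mathsf{Ineq}$, the $\beta_j$ are positive in $p$ and the $\gamma_j$ are negative in $p$, replace $S$ by $\{\beta_j(\bigvee_i\alpha_i/p)\le\gamma_j(\bigvee_i\alpha_i/p)\}_j$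 (the empty disjunction is $\bot$). *Left Ackermann rule.* If $S=\{p\le\alpha_i\}_{i=1}^n\cup\{\beta_j\le\gamma_j\}_j$, where $p$ occurs neither in the $\alpha_i$ nor in $\mathsf{Ineq}$, the $\beta_j$ are negative in $p$ and the $\gamma_j$ are positive in $p$, replace $S$ by $\{\beta_j(\bigwedge_i\alpha_i/p)\le\gamma_j(\bigwedge_i\alpha_i/p)\}_j$ (the empty conjunction is $\top$). **Success.** ALBA *succeeds* on $\varphi\le\psi$ if the rules of Stage 1 can be applied exhaustively, and in whatever order this is done the result is a finite set of inequalities such that the initial system of each of them can be rewritten by the rules of Stage 2 into a system containing no propositional variables. **Theorem.** ALBA succeeds on every basic inequality that is $(\Omega,\epsilon)$-inductive for some order-type $\epsilon$ and some irreflexive and transitive relation $<_\Omega$ on the variables. In particular, ALBA succeeds on every basic inequality that is $\epsilon$-Sahlqvist for some order-type $\epsilon$. -/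

import Mathlib

namespace ALBA

/-- Signs of nodes in signed generation trees.  The order-type `1` of a variable is
represented by `plus` and the order-type `∂` by `minus`, so that a leaf with sign `s` and
variable `p` is `ε`-critical exactly when `s = ε p`. -/
inductive Sign : Type
  | plus : Sign
  | minus : Sign

/-- The opposite sign (also: the opposite order-type). -/
def Sign.flip : Sign → Sign
  | .plus => .minus
  | .minus => .plus

/-- Formulas of the expanded modal language over propositional variables `P` and nominals `N`.
The abbreviations are primitive symbols; `bdia` and `bbox` are the black diamond and the
black box (the adjoints of `box` and `dia`). -/
inductive Form (P : Type*) (N : Type*)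
  | var : P → Form P N
  | nom : N → Form P N
  | bot : Form P N
  | top : Form P N
  | neg : Form P N → Form P N
  | and : Form P N → Form P N → Form P N
  | or : Form P N → Form P N → Form P N
  | imp : Form P N → Form P N → Form P N
  | box : Form P N → Form P N
  | dia : Form P N → Form P N
  | bdia : Form P N → Form P N
  | bbox : Form P N → Form P N

namespace Form

variable {P : Type*} {N : Type*}

/-- The formula belongs to the basic modal language: no nominals, no black connectives. -/
def IsBasic : Form P N → Prop
  | var _ => True
  | nom _ => False
  | bot => True
  | top => True
  | neg a => a.IsBasic
  | and a b => a.IsBasic ∧ b.IsBasic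
  | or a b => a.IsBasic ∧ b.IsBasic
  | imp a b => a.IsBasic ∧ b.IsBasic
  | box a => a.IsBasic
  | dia a => a.IsBasic
  | bdia _ => False
  | bbox _ => False

/-- The propositional variables that occur in a formula. -/
def vars : Form P N → Set P
  | var p => {p}
  | nom _ => ∅
  | bot => ∅
  | top => ∅
  | neg a => a.vars
  | and a b => a.vars ∪ b.vars
  | or a b => a.vars ∪ b.vars
  | imp a b => a.vars ∪ b.vars
  | box a => a.vars
  | dia a => a.vars
  | bdia a => a.vars
  | bbox a => a.vars

/-- The nominals that occur in a formula. -/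
def noms : Form P N → Set N
  | var _ => ∅
  | nom i => {i}
  | bot => ∅
  | top => ∅
  | neg a => a.noms
  | and a b => a.noms ∪ b.noms
  | or a b => a.noms ∪ b.noms
  | imp a b => a.noms ∪ b.noms
  | box a => a.noms
  | dia a => a.noms
  | bdia a => a.noms
  | bbox a => a.noms

/-- The signed variable leaves of the generation tree of a formula whose root has sign `s`. -/
def leaves (s : Sign) : Form P N → Set (Sign × P)
  | var p => {(s, p)}
  | nom _ => ∅
  | bot => ∅
  | top => ∅
  | neg a => a.leaves s.flip
  | and a b => a.leaves s ∪ b.leaves s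
  | or a b => a.leaves s ∪ b.leaves s
  | imp a b => a.leaves s.flip ∪ b.leaves s
  | box a => a.leaves s
  | dia a => a.leaves s
  | bdia a => a.leaves s
  | bbox a => a.leaves s

/-- All occurrences of `p` are positive. -/
def PositiveIn (p : P) (a : Form P N) : Prop := (Sign.minus, p) ∉ a.leaves Sign.plus

/-- All occurrences of `p` are negative. -/
def NegativeIn (p : P) (a : Form P N) : Prop := (Sign.plus, p) ∉ a.leaves Sign.plus

open Classical in
/-- Uniform substitution of the formula `c` for the variable `p`. -/
noncomputable def subst (p : P) (c : Form P N) : Form P N → Form P N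
  | var q => if q = p then c else var q
  | nom i => nom i
  | bot => bot
  | top => top
  | neg a => neg (subst p c a)
  | and a b => and (subst p c a) (subst p c b)
  | or a b => or (subst p c a) (subst p c b)
  | imp a b => imp (subst p c a) (subst p c b)
  | box a => box (subst p c a)
  | dia a => dia (subst p c a)
  | bdia a => bdia (subst p c a)
  | bbox a => bbox (subst p c a)

/-- Finite disjunction; the empty one is `bot`. -/
def bigOr : List (Form P N) → Form P N
  | [] => bot
  | [a] => a
  | a :: b :: l => or a (bigOr (b :: l))

/-- Finite conjunction; the empty one is `top`. -/
def bigAnd : List (Form P N) → Form P N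
  | [] => top
  | [a] => a
  | a :: b :: l => and a (bigAnd (b :: l))

end Form

/-- A frame is an inner node of a generation tree together with the choice of the child through
which a branch passes; for a binary connective it records the other child. For instance
`andL b` is a conjunction whose right conjunct is `b`, on a branch that goes through the
left conjunct. -/
inductive Frame (P : Type*) (N : Type*)
  | neg : Frame P N
  | andL : Form P N → Frame P N
  | andR : Form P N → Frame P N
  | orL : Form P N → Frame P N
  | orR : Form P N → Frame P N
  | impL : Form P N → Frame P N
  | impR : Form P N → Frame P N
  | box : Frame P N
  | dia : Frame P N
  | bdia : Frame P N
  | bbox : Frame P N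

namespace Frame

variable {P : Type*} {N : Type*}

/-- The formula that arises when `a` is the child on the branch. -/
def app : Frame P N → Form P N → Form P N
  | neg, a => .neg a
  | andL b, a => .and a b
  | andR b, a => .and b a
  | orL b, a => .or a b
  | orR b, a => .or b a
  | impL b, a => .imp a b
  | impR b, a => .imp b a
  | box, a => .box a
  | dia, a => .dia a
  | bdia, a => .bdia a
  | bbox, a => .bbox a

/-- The sign of the child on the branch, when the node has sign `s`. -/
def childSign : Frame P N → Sign → Sign
  | neg, s => s.flip
  | impL _, s => s.flip
  | _, s => s

/-- The children off the branch, with their signs, when the node has sign `s`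
(there is at most one). -/
def siblings : Frame P N → Sign → Set (Sign × Form P N)
  | andL b, s => {(s, b)}
  | andR b, s => {(s, b)}
  | orL b, s => {(s, b)}
  | orR b, s => {(s, b)}
  | impL b, s => {(s, b)}
  | impR b, s => {(s.flip, b)}
  | _, _ => ∅

/-- `Δ`-adjoint nodes: `+∨`, `+∧`, `-∧`, `-∨`. -/
def IsDeltaAdjoint : Sign → Frame P N → Prop
  | _, andL _ => True
  | _, andR _ => True
  | _, orL _ => True
  | _, orR _ => True
  | _, _ => False

/-- Syntactically left residual nodes: `+∧`, `+◇`, `+¬`, `-∨`, `-□`, `-¬`, `-→`. -/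
def IsSLR : Sign → Frame P N → Prop
  | .plus, andL _ => True
  | .plus, andR _ => True
  | .plus, dia => True
  | .plus, neg => True
  | .minus, orL _ => True
  | .minus, orR _ => True
  | .minus, box => True
  | .minus, neg => True
  | .minus, impL _ => True
  | .minus, impR _ => True
  | _, _ => False

/-- Syntactically right adjoint nodes: `+∧`, `+□`, `+¬`, `-∨`, `-◇`, `-¬`. -/
def IsSRA : Sign → Frame P N → Prop
  | .plus, andL _ => True
  | .plus, andR _ => True
  | .plus, box => True
  | .plus, neg => True
  | .minus, orL _ => True
  | .minus, orR _ => True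
  | .minus, dia => True
  | .minus, neg => True
  | _, _ => False

/-- Syntactically right residual nodes: `+∨`, `+→`, `-∧`. -/
def IsSRR : Sign → Frame P N → Prop
  | .plus, orL _ => True
  | .plus, orR _ => True
  | .plus, impL _ => True
  | .plus, impR _ => True
  | .minus, andL _ => True
  | .minus, andR _ => True
  | _, _ => False

/-- Skeleton nodes: `Δ`-adjoints and SLR nodes. -/
def IsSkeleton (s : Sign) (f : Frame P N) : Prop := f.IsDeltaAdjoint s ∨ f.IsSLR s

/-- PIA nodes: SRA and SRR nodes. -/
def IsPIA (s : Sign) (f : Frame P N) : Prop := f.IsSRA s ∨ f.IsSRR s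

end Frame

/-- A branch, i.e. a path from the root of a generation tree to some node below it, as the list
of the nodes above that node, the root coming first. It is also a one-hole context. -/
abbrev Branch (P : Type*) (N : Type*) := List (Frame P N)

namespace Branch

variable {P : Type*} {N : Type*}

/-- The formula obtained by putting `a` at the end of the branch. -/
def plug : Branch P N → Form P N → Form P N
  | [], a => a
  | f :: C, a => f.app (plug C a)

/-- The sign at the end of the branch when the root has sign `s`. -/
def endSign : Branch P N → Sign → Sign
  | [], s => s
  | f :: C, s => endSign C (f.childSign s)

/-- The nodes of the branch with their signs, when the root has sign `s`. -/
def nodes : Branch P N → Sign → List (Sign × Frame P N)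
  | [], _ => []
  | f :: C, s => (s, f) :: nodes C (f.childSign s)

/-- All nodes of the branch are SLR nodes. -/
def AllSLR (C : Branch P N) (s : Sign) : Prop := ∀ n ∈ nodes C s, n.2.IsSLR n.1

/-- All nodes of the branch are Skeleton nodes. -/
def AllSkeleton (C : Branch P N) (s : Sign) : Prop := ∀ n ∈ nodes C s, n.2.IsSkeleton n.1

end Branch

namespace Form

variable {P : Type*} {N : Type*}

/-- The signed generation tree `s a` is `(Ω, ε)`-inductive: every critical branch consists of a
Skeleton part `P₂` starting at the root, followed by a PIA part `P₁` ending at the leaf, and each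
SRR node in the PIA part has, off the branch, a subtree that agrees with the order-type opposite
to `ε` and whose variables are all `Ω`-below the variable at the leaf. -/
def IsInductive (Ω : P → P → Prop) (ε : P → Sign) (s : Sign) (a : Form P N) : Prop :=
  ∀ (C : Branch P N) (p : P), C.plug (var p) = a → C.endSign s = ε p →
    ∃ P₂ P₁ : List (Sign × Frame P N), C.nodes s = P₂ ++ P₁ ∧
      (∀ n ∈ P₂, n.2.IsSkeleton n.1) ∧
      (∀ n ∈ P₁, n.2.IsPIA n.1) ∧
      (∀ n ∈ P₁, n.2.IsSRR n.1 → ∀ c ∈ n.2.siblings n.1,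
        (∀ l ∈ c.2.leaves c.1, l.1 = (ε l.2).flip) ∧ ∀ q ∈ c.2.vars, Ω q p)

/-- The signed generation tree `s a` is `ε`-Sahlqvist: every critical branch is excellent. -/
def IsSahlqvist (ε : P → Sign) (s : Sign) (a : Form P N) : Prop :=
  ∀ (C : Branch P N) (p : P), C.plug (var p) = a → C.endSign s = ε p →
    ∃ P₂ P₁ : List (Sign × Frame P N), C.nodes s = P₂ ++ P₁ ∧
      (∀ n ∈ P₂, n.2.IsSkeleton n.1) ∧ (∀ n ∈ P₁, n.2.IsSRA n.1)

end Form

/-- Inequalities `lhs ≤ rhs`. -/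
structure Ineq (P : Type*) (N : Type*) where
  lhs : Form P N
  rhs : Form P N

namespace Ineq

variable {P : Type*} {N : Type*}

def IsBasic (I : Ineq P N) : Prop := I.lhs.IsBasic ∧ I.rhs.IsBasic

def vars (I : Ineq P N) : Set P := I.lhs.vars ∪ I.rhs.vars

def noms (I : Ineq P N) : Set N := I.lhs.noms ∪ I.rhs.noms

/-- No propositional variables occur. -/
def IsPure (I : Ineq P N) : Prop := I.vars = ∅

noncomputable def subst (p : P) (c : Form P N) (I : Ineq P N) : Ineq P N :=
  ⟨Form.subst p c I.lhs, Form.subst p c I.rhs⟩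

def IsInductive (Ω : P → P → Prop) (ε : P → Sign) (I : Ineq P N) : Prop :=
  I.lhs.IsInductive Ω ε .plus ∧ I.rhs.IsInductive Ω ε .minus

def IsSahlqvist (ε : P → Sign) (I : Ineq P N) : Prop :=
  I.lhs.IsSahlqvist ε .plus ∧ I.rhs.IsSahlqvist ε .minus

end Ineq

section Algorithm

variable {P : Type*} {N : Type*}

/-- The local distribution rules at a node of the given sign: `+◇`, `+∧`, `-¬`, `-→` are pushed
down over `+∨`, and `-□`, `-∨`, `+¬`, `-→` over `-∧`. -/
inductive Distributes : Sign → Form P N → Form P N → Prop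
  | dia_or (a b : Form P N) : Distributes .plus (.dia (.or a b)) (.or (.dia a) (.dia b))
  | or_and (a b c : Form P N) :
      Distributes .plus (.and (.or a b) c) (.or (.and a c) (.and b c))
  | and_or (a b c : Form P N) :
      Distributes .plus (.and c (.or a b)) (.or (.and c a) (.and c b))
  | neg_or (a b : Form P N) : Distributes .minus (.neg (.or a b)) (.and (.neg a) (.neg b))
  | or_imp (a b c : Form P N) :
      Distributes .minus (.imp (.or a b) c) (.and (.imp a c) (.imp b c))
  | box_and (a b : Form P N) : Distributes .minus (.box (.and a b)) (.and (.box a) (.box b))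
  | and_or_left (a b c : Form P N) :
      Distributes .minus (.or (.and a b) c) (.and (.or a c) (.or b c))
  | and_or_right (a b c : Form P N) :
      Distributes .minus (.or c (.and a b)) (.and (.or c a) (.or c b))
  | neg_and (a b : Form P N) : Distributes .plus (.neg (.and a b)) (.or (.neg a) (.neg b))
  | imp_and (a b c : Form P N) :
      Distributes .minus (.imp c (.and a b)) (.and (.imp c a) (.imp c b))

/-- The splitting rules: the first inequality is replaced by the other two. -/
inductive Splits : Ineq P N → Ineq P N → Ineq P N → Prop
  | and_right (a b c : Form P N) : Splits ⟨a, .and b c⟩ ⟨a, b⟩ ⟨a, c⟩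
  | or_left (a b c : Form P N) : Splits ⟨.or a b, c⟩ ⟨a, c⟩ ⟨b, c⟩

/-- One application of a rule of Stage 1 to an inequality, with the set of inequalities that
replace it. Distribution takes place in the Skeleton part of the generation trees of `+lhs` and
`-rhs`; a variable is eliminated only if it occurs. -/
inductive Stage1Rule : Ineq P N → Set (Ineq P N) → Prop
  | dist_left (C : Branch P N) (a b r : Form P N) :
      C.AllSkeleton .plus → Distributes (C.endSign .plus) a b →
      Stage1Rule ⟨C.plug a, r⟩ {⟨C.plug b, r⟩}
  | dist_right (C : Branch P N) (a b l : Form P N) :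
      C.AllSkeleton .minus → Distributes (C.endSign .minus) a b →
      Stage1Rule ⟨l, C.plug a⟩ {⟨l, C.plug b⟩}
  | elim_bot (p : P) (I : Ineq P N) :
      p ∈ I.vars → I.lhs.NegativeIn p → I.rhs.PositiveIn p →
      Stage1Rule I {Ineq.subst p .bot I}
  | elim_top (p : P) (I : Ineq P N) :
      p ∈ I.vars → I.lhs.PositiveIn p → I.rhs.NegativeIn p →
      Stage1Rule I {Ineq.subst p .top I}
  | split (I J K : Ineq P N) : Splits I J K → Stage1Rule I {J, K}

/-- One step of Stage 1 on a set of inequalities. -/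
def Stage1Step (X Y : Set (Ineq P N)) : Prop :=
  ∃ I ∈ X, ∃ L, Stage1Rule I L ∧ Y = (X \ {I}) ∪ L

/-- `X` is a result of applying the rules of Stage 1 exhaustively to the inequality `I`. -/
def Stage1Result (I : Ineq P N) (X : Set (Ineq P N)) : Prop :=
  Relation.ReflTransGen Stage1Step {I} X ∧ ∀ J ∈ X, ∀ L, ¬ Stage1Rule J L

/-- A system `(S, Ineq)`. -/
structure ASystem (P : Type*) (N : Type*) where
  S : Set (Ineq P N)
  ineq : Ineq P N

namespace ASystem

/-- No propositional variables occur in the system. -/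
def IsPure (T : ASystem P N) : Prop := (∀ J ∈ T.S, J.IsPure) ∧ T.ineq.IsPure

/-- The nominal `i` does not occur in the system. -/
def Fresh (i : N) (T : ASystem P N) : Prop := (∀ J ∈ T.S, i ∉ J.noms) ∧ i ∉ T.ineq.noms

end ASystem

/-- The residuation rules. -/
inductive Residuates : Ineq P N → Ineq P N → Prop
  | dia (c d : Form P N) : Residuates ⟨.dia c, d⟩ ⟨c, .bbox d⟩
  | neg_left (c d : Form P N) : Residuates ⟨.neg c, d⟩ ⟨.neg d, c⟩
  | box (c d : Form P N) : Residuates ⟨c, .box d⟩ ⟨.bdia c, d⟩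
  | neg_right (c d : Form P N) : Residuates ⟨c, .neg d⟩ ⟨d, .neg c⟩
  | and_one (c d b : Form P N) : Residuates ⟨.and c d, b⟩ ⟨c, .imp d b⟩
  | and_two (c d b : Form P N) : Residuates ⟨.and c d, b⟩ ⟨d, .imp c b⟩
  | or_one (c d b : Form P N) : Residuates ⟨c, .or d b⟩ ⟨.and c (.neg d), b⟩
  | or_two (c d b : Form P N) : Residuates ⟨c, .or d b⟩ ⟨.and c (.neg b), d⟩
  | imp_one (c d b : Form P N) : Residuates ⟨c, .imp d b⟩ ⟨.and c d, b⟩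
  | imp_two (c d b : Form P N) : Residuates ⟨c, .imp d b⟩ ⟨d, .imp c b⟩

/-- The branch `C` from a root of sign `s` is SLR, and it cannot be extended to a longer SLR
branch through the subformula `c` at its end (this makes approximation at `c` pivotal). -/
def MaximalSLR (C : Branch P N) (s : Sign) (c : Form P N) : Prop :=
  C.AllSLR s ∧ ∀ (f : Frame P N) (d : Form P N), c = f.app d → ¬ f.IsSLR (C.endSign s)

/-- One application of a reduction rule of Stage 2: the four approximation rules (applied
pivotally), the residuation and splitting rules (applied to an inequality in `S`), and the two
Ackermann rules. -/
inductive Stage2Step : ASystem P N → ASystem P N → Prop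
  | approx_left_pos (S : Set (Ineq P N)) (C : Branch P N) (c r : Form P N) (i : N) :
      C.endSign .plus = .plus → MaximalSLR C .plus c → c.IsBasic →
      ASystem.Fresh i ⟨S, ⟨C.plug c, r⟩⟩ →
      Stage2Step ⟨S, ⟨C.plug c, r⟩⟩ ⟨S ∪ {⟨.nom i, c⟩}, ⟨C.plug (.nom i), r⟩⟩
  | approx_left_neg (S : Set (Ineq P N)) (C : Branch P N) (c r : Form P N) (i : N) :
      C.endSign .plus = .minus → MaximalSLR C .plus c → c.IsBasic →
      ASystem.Fresh i ⟨S, ⟨C.plug c, r⟩⟩ →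
      Stage2Step ⟨S, ⟨C.plug c, r⟩⟩
        ⟨S ∪ {⟨c, .neg (.nom i)⟩}, ⟨C.plug (.neg (.nom i)), r⟩⟩
  | approx_right_pos (S : Set (Ineq P N)) (C : Branch P N) (c l : Form P N) (i : N) :
      C.endSign .minus = .plus → MaximalSLR C .minus c → c.IsBasic →
      ASystem.Fresh i ⟨S, ⟨l, C.plug c⟩⟩ →
      Stage2Step ⟨S, ⟨l, C.plug c⟩⟩ ⟨S ∪ {⟨.nom i, c⟩}, ⟨l, C.plug (.nom i)⟩⟩
  | approx_right_neg (S : Set (Ineq P N)) (C : Branch P N) (c l : Form P N) (i : N) :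
      C.endSign .minus = .minus → MaximalSLR C .minus c → c.IsBasic →
      ASystem.Fresh i ⟨S, ⟨l, C.plug c⟩⟩ →
      Stage2Step ⟨S, ⟨l, C.plug c⟩⟩
        ⟨S ∪ {⟨c, .neg (.nom i)⟩}, ⟨l, C.plug (.neg (.nom i))⟩⟩
  | residuation (S : Set (Ineq P N)) (E I J : Ineq P N) :
      I ∈ S → Residuates I J → Stage2Step ⟨S, E⟩ ⟨(S \ {I}) ∪ {J}, E⟩
  | splitting (S : Set (Ineq P N)) (E I J K : Ineq P N) :
      I ∈ S → Splits I J K → Stage2Step ⟨S, E⟩ ⟨(S \ {I}) ∪ {J, K}, E⟩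
  | right_ackermann (p : P) (as : List (Form P N)) (S T : Set (Ineq P N)) (E : Ineq P N) :
      S = {J | ∃ a ∈ as, J = ⟨a, .var p⟩} ∪ T →
      (∀ a ∈ as, p ∉ a.vars) → p ∉ E.vars →
      (∀ J ∈ T, J.lhs.PositiveIn p ∧ J.rhs.NegativeIn p) →
      Stage2Step ⟨S, E⟩ ⟨Ineq.subst p (Form.bigOr as) '' T, E⟩
  | left_ackermann (p : P) (as : List (Form P N)) (S T : Set (Ineq P N)) (E : Ineq P N) :
      S = {J | ∃ a ∈ as, J = ⟨.var p, a⟩} ∪ T →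
      (∀ a ∈ as, p ∉ a.vars) → p ∉ E.vars →
      (∀ J ∈ T, J.lhs.NegativeIn p ∧ J.rhs.PositiveIn p) →
      Stage2Step ⟨S, E⟩ ⟨Ineq.subst p (Form.bigAnd as) '' T, E⟩

/-- ALBA succeeds on `I`: the rules of Stage 1 can be applied exhaustively, and, in whatever order
this is done, the result is a finite set of inequalities, and the initial system of each of these
inequalities can be rewritten by the rules of Stage 2 into a system without propositional
variables. -/
def Succeeds (I : Ineq P N) : Prop :=
  (∃ X, Stage1Result I X) ∧
    ∀ X, Stage1Result I X → X.Finite ∧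
      ∀ J ∈ X, ∃ T : ASystem P N,
        Relation.ReflTransGen Stage2Step ⟨∅, J⟩ T ∧ T.IsPure

end Algorithm

end ALBA

namespace ALBA

section

variable {P : Type*} {N : Type*}

/-! Inductivity speaks of whole branches, but its content is local: below a Skeleton part, each node
on a critical branch is PIA, and an SRR node has a harmless sibling. The recursive predicates `Ind`
and `Pia` extract this local form, and the rest of the argument uses only them.

Stage 1 terminates because a numerical weight, in which `+∨` and `-∧` add while the nodes
distributing over them multiply, makes the total weight of the set drop at every step. Inductivity
survives: distribution rearranges and copies Skeleton nodes, constants only erase leaves, and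
splitting only cuts off a root. In a normal form the Skeleton nodes that are not SLR, namely `+∨`
and `-∧`, have left the Skeleton part: under an SLR node they could be distributed over, at the root
they could be split. What remains is an SLR part on top of PIA trees (`Ind.definite`).

Approximation cuts the tree exactly at this border, leaving a pure inequality and constraints of the
form `i ≤ γ` or `γ ≤ ¬i` with `γ` a PIA tree. Such a constraint is solved by descending along its
critical branches: SRA nodes are crossed by adjunction or splitting, and an SRR node by moving the
child off the branch to the other side. The invariant is that the accumulated side has no critical
leaf and that its variables lie `Ω`-below every critical variable still to be reached
(`Pia.isSolvable`). The descent ends with inequalities free of critical leaves or with bounds on a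
single variable.

All critical occurrences of a variable `p` are then isolated in its bounds, so an Ackermann rule
removes it. Irreflexivity keeps `p` out of its own bounds, and transitivity makes the solved shape
survive the substitution; hence the variables can be eliminated in any order
(`exists_pure_of_solved`). The Sahlqvist case is the inductive one for the empty relation. -/

@[simp] theorem Sign.flip_flip (s : Sign) : s.flip.flip = s := by cases s <;> rfl

theorem Sign.ne_flip (s : Sign) : s ≠ s.flip := by cases s <;> simp [Sign.flip]

/-! ### Recursive description of inductive trees -/

namespace Form

/-- No leaf of the signed generation tree `s a` is `ε`-critical. -/
def NonCritical (ε : P → Sign) (s : Sign) (a : Form P N) : Prop :=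
  ∀ p, (ε p, p) ∉ a.leaves s

/-- The side condition on `b` at an SRR node whose other child is `a`. -/
def SideCondition (Ω : P → P → Prop) (ε : P → Sign) (s : Sign) (a : Form P N)
    (t : Sign) (b : Form P N) : Prop :=
  ∀ p, (ε p, p) ∈ a.leaves s → b.NonCritical ε t ∧ ∀ q ∈ b.vars, Ω q p

/-- Every critical branch of `s a` consists of PIA nodes satisfying the side conditions,
by recursion on the formula. -/
def Pia (Ω : P → P → Prop) (ε : P → Sign) : Sign → Form P N → Prop
  | _, var _ => True
  | _, nom _ => True
  | _, bot => True
  | _, top => True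
  | s, neg a => a.Pia Ω ε s.flip
  | .plus, and a b => a.Pia Ω ε .plus ∧ b.Pia Ω ε .plus
  | .minus, and a b => a.Pia Ω ε .minus ∧ b.Pia Ω ε .minus ∧
      SideCondition Ω ε .minus a .minus b ∧ SideCondition Ω ε .minus b .minus a
  | .plus, or a b => a.Pia Ω ε .plus ∧ b.Pia Ω ε .plus ∧
      SideCondition Ω ε .plus a .plus b ∧ SideCondition Ω ε .plus b .plus a
  | .minus, or a b => a.Pia Ω ε .minus ∧ b.Pia Ω ε .minus
  | .plus, imp a b => a.Pia Ω ε .minus ∧ b.Pia Ω ε .plus ∧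
      SideCondition Ω ε .minus a .plus b ∧ SideCondition Ω ε .plus b .minus a
  | .minus, imp a b => a.NonCritical ε .plus ∧ b.NonCritical ε .minus
  | .plus, box a => a.Pia Ω ε .plus
  | .minus, box a => a.NonCritical ε .minus
  | .plus, dia a => a.NonCritical ε .plus
  | .minus, dia a => a.Pia Ω ε .minus
  | s, bdia a => a.NonCritical ε s
  | s, bbox a => a.NonCritical ε s

/-- Every critical branch of `s a` is inductive, by recursion on the formula. -/
def Ind (Ω : P → P → Prop) (ε : P → Sign) : Sign → Form P N → Prop
  | _, var _ => True
  | _, nom _ => True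
  | _, bot => True
  | _, top => True
  | s, neg a => a.Ind Ω ε s.flip
  | s, and a b => a.Ind Ω ε s ∧ b.Ind Ω ε s
  | s, or a b => a.Ind Ω ε s ∧ b.Ind Ω ε s
  -- A node `+→`, `+□` or `-◇` is not Skeleton, so the PIA part of every critical branch through it
  -- has begun here at the latest.
  | .plus, imp a b => (imp a b).Pia Ω ε .plus
  | .minus, imp a b => a.Ind Ω ε .plus ∧ b.Ind Ω ε .minus
  | .plus, box a => (box a).Pia Ω ε .plus
  | .minus, box a => a.Ind Ω ε .minus
  | .plus, dia a => a.Ind Ω ε .plus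
  | .minus, dia a => (dia a).Pia Ω ε .minus
  | s, bdia a => (bdia a).Pia Ω ε s
  | s, bbox a => (bbox a).Pia Ω ε s

/-- Links the two views of an occurrence: an element of the set of signed leaves, used by the
recursive predicates, and a one-hole context, used by the definition of inductivity. -/
theorem exists_branch_of_mem_leaves (a : Form P N) {s t : Sign} {p : P} :
    (t, p) ∈ a.leaves s → ∃ C : Branch P N, C.plug (var p) = a ∧ C.endSign s = t := by
  induction a generalizing s with
  | var q =>
    intro h
    obtain ⟨rfl, rfl⟩ := Prod.mk.inj (Set.mem_singleton_iff.mp h)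
    exact ⟨[], rfl, rfl⟩
  | nom | bot | top => exact fun h => h.elim
  | neg a ih =>
    intro h
    obtain ⟨C, rfl, rfl⟩ := ih h
    exact ⟨.neg :: C, rfl, rfl⟩
  | and a b iha ihb =>
    rintro (h | h)
    · obtain ⟨C, rfl, rfl⟩ := iha h
      exact ⟨.andL b :: C, rfl, rfl⟩
    · obtain ⟨C, rfl, rfl⟩ := ihb h
      exact ⟨.andR a :: C, rfl, rfl⟩
  | or a b iha ihb =>
    rintro (h | h)
    · obtain ⟨C, rfl, rfl⟩ := iha h
      exact ⟨.orL b :: C, rfl, rfl⟩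
    · obtain ⟨C, rfl, rfl⟩ := ihb h
      exact ⟨.orR a :: C, rfl, rfl⟩
  | imp a b iha ihb =>
    rintro (h | h)
    · obtain ⟨C, rfl, rfl⟩ := iha h
      exact ⟨.impL b :: C, rfl, rfl⟩
    · obtain ⟨C, rfl, rfl⟩ := ihb h
      exact ⟨.impR a :: C, rfl, rfl⟩
  | box a ih =>
    intro h
    obtain ⟨C, rfl, rfl⟩ := ih h
    exact ⟨.box :: C, rfl, rfl⟩
  | dia a ih =>
    intro h
    obtain ⟨C, rfl, rfl⟩ := ih h
    exact ⟨.dia :: C, rfl, rfl⟩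
  | bdia a ih =>
    intro h
    obtain ⟨C, rfl, rfl⟩ := ih h
    exact ⟨.bdia :: C, rfl, rfl⟩
  | bbox a ih =>
    intro h
    obtain ⟨C, rfl, rfl⟩ := ih h
    exact ⟨.bbox :: C, rfl, rfl⟩

/-- The nodes of a branch ending in the variable `p` are PIA nodes satisfying the side
conditions. -/
def PiaNodes (Ω : P → P → Prop) (ε : P → Sign) (p : P) (L : List (Sign × Frame P N)) : Prop :=
  (∀ n ∈ L, n.2.IsPIA n.1) ∧
    ∀ n ∈ L, n.2.IsSRR n.1 → ∀ c ∈ n.2.siblings n.1,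
      (∀ l ∈ c.2.leaves c.1, l.1 = (ε l.2).flip) ∧ ∀ q ∈ c.2.vars, Ω q p

/-- All critical branches of `s a` consist of PIA nodes satisfying the side conditions. -/
def AllPia (Ω : P → P → Prop) (ε : P → Sign) (s : Sign) (a : Form P N) : Prop :=
  ∀ (C : Branch P N) (p : P), C.plug (var p) = a → C.endSign s = ε p →
    PiaNodes Ω ε p (C.nodes s)

variable {Ω : P → P → Prop} {ε : P → Sign}

theorem AllPia.child {s : Sign} {f : Frame P N} {a : Form P N}
    (h : AllPia Ω ε s (f.app a)) : AllPia Ω ε (f.childSign s) a := by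
  intro C p hC hs
  have := h (f :: C) p (by simp [Branch.plug, hC]) hs
  exact ⟨fun n hn => this.1 n (List.mem_cons_of_mem _ hn),
    fun n hn => this.2 n (List.mem_cons_of_mem _ hn)⟩

/-- A critical leaf of the child yields a critical branch through the root. Conversely, a child
without critical leaves puts no constraint on the root, which is why the side conditions are
conditional on such a leaf. -/
theorem AllPia.root {s : Sign} {f : Frame P N} {a : Form P N}
    (h : AllPia Ω ε s (f.app a)) {p : P} (hp : (ε p, p) ∈ a.leaves (f.childSign s)) :
    f.IsPIA s ∧ (f.IsSRR s → ∀ c ∈ f.siblings s,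
      (∀ l ∈ c.2.leaves c.1, l.1 = (ε l.2).flip) ∧ ∀ q ∈ c.2.vars, Ω q p) := by
  obtain ⟨C, rfl, hs⟩ := exists_branch_of_mem_leaves a hp
  have := h (f :: C) p rfl hs
  exact ⟨this.1 (s, f) List.mem_cons_self, this.2 (s, f) List.mem_cons_self⟩

theorem AllPia.nonCritical {s : Sign} {f : Frame P N} {a : Form P N}
    (h : AllPia Ω ε s (f.app a)) (hf : ¬ f.IsPIA s) : a.NonCritical ε (f.childSign s) :=
  fun _ hp => hf (h.root hp).1

theorem AllPia.sideCondition {s : Sign} {f : Frame P N} {a : Form P N}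
    (h : AllPia Ω ε s (f.app a)) (hf : f.IsSRR s) {t : Sign} {b : Form P N}
    (hb : (t, b) ∈ f.siblings s) : SideCondition Ω ε (f.childSign s) a t b := by
  intro p hp
  have := (h.root hp).2 hf (t, b) hb
  exact ⟨fun q hq => Sign.ne_flip _ (this.1 _ hq), this.2⟩

theorem AllPia.pia {s : Sign} {a : Form P N} (h : AllPia Ω ε s a) : a.Pia Ω ε s := by
  induction a generalizing s with
  | var | nom | bot | top => simp [Pia]
  | neg a ih => exact ih (AllPia.child (f := .neg) h)
  | and a b iha ihb =>
    have ha := iha (AllPia.child (f := .andL b) h)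
    have hb := ihb (AllPia.child (f := .andR a) h)
    cases s with
    | plus => exact ⟨ha, hb⟩
    | minus =>
      exact ⟨ha, hb, AllPia.sideCondition (f := .andL b) h trivial rfl,
        AllPia.sideCondition (f := .andR a) h trivial rfl⟩
  | or a b iha ihb =>
    have ha := iha (AllPia.child (f := .orL b) h)
    have hb := ihb (AllPia.child (f := .orR a) h)
    cases s with
    | minus => exact ⟨ha, hb⟩
    | plus =>
      exact ⟨ha, hb, AllPia.sideCondition (f := .orL b) h trivial rfl,
        AllPia.sideCondition (f := .orR a) h trivial rfl⟩
  | imp a b iha ihb =>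
    cases s with
    | plus =>
      exact ⟨iha (AllPia.child (f := .impL b) h), ihb (AllPia.child (f := .impR a) h),
        AllPia.sideCondition (f := .impL b) h trivial rfl,
        AllPia.sideCondition (f := .impR a) h trivial rfl⟩
    | minus =>
      exact ⟨AllPia.nonCritical (f := .impL b) h (by rintro (h | h) <;> exact h),
        AllPia.nonCritical (f := .impR a) h (by rintro (h | h) <;> exact h)⟩
  | box a ih =>
    cases s with
    | plus => exact ih (AllPia.child (f := .box) h)
    | minus => exact AllPia.nonCritical (f := .box) h (by rintro (h | h) <;> exact h)
  | dia a ih =>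
    cases s with
    | minus => exact ih (AllPia.child (f := .dia) h)
    | plus => exact AllPia.nonCritical (f := .dia) h (by rintro (h | h) <;> exact h)
  | bdia a ih =>
    cases s <;> exact AllPia.nonCritical (f := .bdia) h (by rintro (h | h) <;> exact h)
  | bbox a ih =>
    cases s <;> exact AllPia.nonCritical (f := .bbox) h (by rintro (h | h) <;> exact h)

/-- The root is removed from the Skeleton part if that part is nonempty, and otherwise from the PIA
part. -/
theorem IsInductive.child {s : Sign} {f : Frame P N} {a : Form P N}
    (h : (f.app a).IsInductive Ω ε s) : a.IsInductive Ω ε (f.childSign s) := by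
  intro C p hC hs
  obtain ⟨P₂, P₁, hn, h2, h1, h0⟩ := h (f :: C) p (by simp [Branch.plug, hC]) hs
  cases P₂ with
  | nil =>
    subst hn
    exact ⟨[], C.nodes (f.childSign s), rfl, by simp,
      fun n hn => h1 n (List.mem_cons_of_mem _ hn),
      fun n hn => h0 n (List.mem_cons_of_mem _ hn)⟩
  | cons x P₂ =>
    exact ⟨P₂, P₁, (List.cons.inj hn).2, fun n hn => h2 n (List.mem_cons_of_mem _ hn), h1, h0⟩

/-- A nonempty Skeleton part would have to contain the root. -/
theorem IsInductive.allPia {s : Sign} {a : Form P N} (h : a.IsInductive Ω ε s)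
    (ha : ∀ (f : Frame P N) (d : Form P N), f.app d = a → ¬ f.IsSkeleton s) :
    AllPia Ω ε s a := by
  intro C p hC hs
  obtain ⟨P₂, P₁, hn, h2, h1, h0⟩ := h C p hC hs
  cases P₂ with
  | nil => rw [hn]; exact ⟨h1, h0⟩
  | cons x P₂ =>
    cases C with
    | nil => simp [Branch.nodes] at hn
    | cons f C =>
      obtain ⟨rfl, -⟩ := List.cons.inj hn
      exact absurd (h2 _ List.mem_cons_self) (ha f _ hC)

theorem IsInductive.ind {s : Sign} {a : Form P N} (h : a.IsInductive Ω ε s) :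
    a.Ind Ω ε s := by
  induction a generalizing s with
  | var | nom | bot | top => simp [Ind]
  | neg a ih => exact ih (IsInductive.child (f := .neg) h)
  | and a b iha ihb =>
    exact ⟨iha (IsInductive.child (f := .andL b) h), ihb (IsInductive.child (f := .andR a) h)⟩
  | or a b iha ihb =>
    exact ⟨iha (IsInductive.child (f := .orL b) h), ihb (IsInductive.child (f := .orR a) h)⟩
  | imp a b iha ihb =>
    cases s with
    | plus =>
      refine (h.allPia ?_).pia
      rintro (_ | _) d hf <;>
        simp [Frame.app, Frame.IsSkeleton, Frame.IsSLR, Frame.IsDeltaAdjoint] at hf ⊢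
    | minus =>
      exact ⟨iha (IsInductive.child (f := .impL b) h), ihb (IsInductive.child (f := .impR a) h)⟩
  | box a ih =>
    cases s with
    | plus =>
      refine (h.allPia ?_).pia
      rintro (_ | _) d hf <;>
        simp [Frame.app, Frame.IsSkeleton, Frame.IsSLR, Frame.IsDeltaAdjoint] at hf ⊢
    | minus => exact ih (IsInductive.child (f := .box) h)
  | dia a ih =>
    cases s with
    | minus =>
      refine (h.allPia ?_).pia
      rintro (_ | _) d hf <;>
        simp [Frame.app, Frame.IsSkeleton, Frame.IsSLR, Frame.IsDeltaAdjoint] at hf ⊢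
    | plus => exact ih (IsInductive.child (f := .dia) h)
  | bdia a ih =>
    cases s <;>
    · refine (h.allPia ?_).pia
      rintro (_ | _) d hf <;>
        simp [Frame.app, Frame.IsSkeleton, Frame.IsSLR, Frame.IsDeltaAdjoint] at hf ⊢
  | bbox a ih =>
    cases s <;>
    · refine (h.allPia ?_).pia
      rintro (_ | _) d hf <;>
        simp [Frame.app, Frame.IsSkeleton, Frame.IsSLR, Frame.IsDeltaAdjoint] at hf ⊢

/-- No signed node is both SRA and SRR, so the side conditions are vacuous and even the empty
relation serves as `Ω`. -/
theorem IsSahlqvist.isInductive {s : Sign} {a : Form P N} (h : a.IsSahlqvist ε s) :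
    a.IsInductive (fun _ _ => False) ε s := by
  intro C p hC hs
  obtain ⟨P₂, P₁, hn, h2, h1⟩ := h C p hC hs
  refine ⟨P₂, P₁, hn, h2, fun n hn => Or.inl (h1 n hn), fun n hn hr => ?_⟩
  have := h1 n hn
  rcases n with ⟨_ | _, _ | _⟩ <;> simp_all [Frame.IsSRA, Frame.IsSRR]

end Form

end

end ALBA

namespace ALBA

section

variable {P : Type*} {N : Type*}

namespace Form

variable {Ω : P → P → Prop} {ε : P → Sign}

/-! ### Stage 1: preservation of basic inductive inequalities -/

theorem _root_.ALBA.Branch.allSkeleton_cons {f : Frame P N} {C : Branch P N} {s : Sign} :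
    Branch.AllSkeleton (f :: C) s ↔
      f.IsSkeleton s ∧ Branch.AllSkeleton C (f.childSign s) := by
  simp [Branch.AllSkeleton, Branch.nodes]

theorem _root_.ALBA.Distributes.isBasic {s : Sign} {a b : Form P N} (h : Distributes s a b)
    (ha : a.IsBasic) : b.IsBasic := by
  cases h <;> simp_all [IsBasic]

theorem _root_.ALBA.Distributes.ind {s : Sign} {a b : Form P N} (h : Distributes s a b)
    (ha : a.Ind Ω ε s) : b.Ind Ω ε s := by
  cases h <;> simp_all [Ind, Sign.flip]

theorem _root_.ALBA.Branch.isBasic_plug {C : Branch P N} {a b : Form P N}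
    (h : a.IsBasic → b.IsBasic) (ha : (C.plug a).IsBasic) : (C.plug b).IsBasic := by
  induction C with
  | nil => exact h ha
  | cons f C ih => cases f <;> simp_all [Branch.plug, Frame.app, IsBasic]

/-- At a Skeleton node `Ind` is merely the conjunction of `Ind` for the children, so a change at the
end of a Skeleton branch is not felt above. At a PIA node it could disturb a side condition. -/
theorem _root_.ALBA.Branch.ind_plug {C : Branch P N} {s : Sign} {a b : Form P N}
    (hC : C.AllSkeleton s) (h : a.Ind Ω ε (C.endSign s) → b.Ind Ω ε (C.endSign s))
    (ha : (C.plug a).Ind Ω ε s) : (C.plug b).Ind Ω ε s := by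
  induction C generalizing s with
  | nil => exact h ha
  | cons f C ih =>
    rw [Branch.allSkeleton_cons] at hC
    have ih := ih hC.2 h
    have hf := hC.1
    cases s <;> cases f <;>
      simp_all [Branch.plug, Frame.app, Ind, Frame.IsSkeleton, Frame.IsDeltaAdjoint, Frame.IsSLR,
        Frame.childSign, Sign.flip]

/-! ### Substitution of variable-free formulas: leaves can only disappear. -/

theorem vars_subst_of_vars_eq_empty {p : P} {c : Form P N} (hc : c.vars = ∅) (a : Form P N) :
    (subst p c a).vars ⊆ a.vars := by
  induction a with
  | var q => unfold subst; split <;> simp_all [vars]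
  | nom | bot | top => simp [subst]
  | neg a ih | box a ih | dia a ih | bdia a ih | bbox a ih => exact ih
  | and a b iha ihb | or a b iha ihb | imp a b iha ihb => exact Set.union_subset_union iha ihb

theorem leaves_eq_empty_of_vars {a : Form P N} (h : a.vars = ∅) (s : Sign) :
    a.leaves s = ∅ := by
  induction a generalizing s <;> simp_all [vars, leaves]

theorem leaves_subst_of_vars_eq_empty {p : P} {c : Form P N} (hc : c.vars = ∅)
    (a : Form P N) (s : Sign) : (subst p c a).leaves s ⊆ a.leaves s := by
  induction a generalizing s with
  | var q =>
    unfold subst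
    split
    · simp [leaves_eq_empty_of_vars hc]
    · exact subset_rfl
  | nom | bot | top => simp [subst]
  | neg a ih => exact ih _
  | box a ih | dia a ih | bdia a ih | bbox a ih => exact ih s
  | and a b iha ihb | or a b iha ihb | imp a b iha ihb =>
    exact Set.union_subset_union (iha _) (ihb _)

theorem NonCritical.subst {p : P} {c : Form P N} (hc : c.vars = ∅) {a : Form P N} {s : Sign}
    (h : a.NonCritical ε s) : (subst p c a).NonCritical ε s :=
  fun q hq => h q (leaves_subst_of_vars_eq_empty hc a s hq)

theorem SideCondition.subst {p : P} {c : Form P N} (hc : c.vars = ∅) {a b : Form P N}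
    {s t : Sign} (h : SideCondition Ω ε s a t b) :
    SideCondition Ω ε s (Form.subst p c a) t (Form.subst p c b) := by
  intro q hq
  have := h q (leaves_subst_of_vars_eq_empty hc a s hq)
  exact ⟨this.1.subst hc, fun r hr => this.2 r (vars_subst_of_vars_eq_empty hc b hr)⟩

theorem Pia.of_vars_eq_empty {c : Form P N} (hc : c.vars = ∅) (s : Sign) : c.Pia Ω ε s := by
  induction c generalizing s <;> cases s <;>
    simp_all [Pia, vars, NonCritical, SideCondition, leaves_eq_empty_of_vars]

theorem Ind.of_vars_eq_empty {c : Form P N} (hc : c.vars = ∅) (s : Sign) : c.Ind Ω ε s := by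
  induction c generalizing s <;> cases s <;>
    simp_all [Ind, vars, Pia.of_vars_eq_empty]

theorem Pia.subst {p : P} {c : Form P N} (hc : c.vars = ∅) {a : Form P N} {s : Sign}
    (h : a.Pia Ω ε s) : (Form.subst p c a).Pia Ω ε s := by
  induction a generalizing s with
  | var q =>
    unfold Form.subst
    split
    · exact Pia.of_vars_eq_empty hc s
    · exact h
  | nom | bot | top => exact h
  | neg a ih => exact ih h
  | box a ih | dia a ih | bdia a ih | bbox a ih =>
    cases s <;> first | exact ih h | exact NonCritical.subst hc h
  | and a b iha ihb | or a b iha ihb | imp a b iha ihb =>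
    cases s <;> first
      | exact ⟨iha h.1, ihb h.2⟩
      | exact ⟨iha h.1, ihb h.2.1, h.2.2.1.subst hc, h.2.2.2.subst hc⟩
      | exact ⟨h.1.subst hc, h.2.subst hc⟩

theorem Ind.subst {p : P} {c : Form P N} (hc : c.vars = ∅) {a : Form P N} {s : Sign}
    (h : a.Ind Ω ε s) : (Form.subst p c a).Ind Ω ε s := by
  induction a generalizing s with
  | var q =>
    unfold Form.subst
    split
    · exact Ind.of_vars_eq_empty hc s
    · exact h
  | nom | bot | top => exact h
  | neg a ih => exact ih h
  | box a ih | dia a ih | bdia a ih | bbox a ih =>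
    cases s <;> first | exact ih h | exact Pia.subst hc h
  | and a b iha ihb | or a b iha ihb | imp a b iha ihb =>
    cases s <;> first
      | exact ⟨iha h.1, ihb h.2⟩
      | exact Pia.subst hc h

theorem IsBasic.subst {p : P} {c : Form P N} (hc : c.IsBasic) {a : Form P N}
    (h : a.IsBasic) : (Form.subst p c a).IsBasic := by
  induction a with
  | var q =>
    unfold Form.subst
    split
    · exact hc
    · exact h
  | nom | bot | top | bdia | bbox => exact h
  | neg a ih | box a ih | dia a ih => exact ih h
  | and a b iha ihb | or a b iha ihb | imp a b iha ihb => exact ⟨iha h.1, ihb h.2⟩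

end Form

/-- Basic inequalities whose two signed generation trees are inductive. -/
def Ineq.IsBasicInd (Ω : P → P → Prop) (ε : P → Sign) (I : Ineq P N) : Prop :=
  I.IsBasic ∧ I.lhs.Ind Ω ε .plus ∧ I.rhs.Ind Ω ε .minus

theorem Stage1Rule.isBasicInd {Ω : P → P → Prop} {ε : P → Sign} {I : Ineq P N}
    {L : Set (Ineq P N)} (h : Stage1Rule I L) (hI : I.IsBasicInd Ω ε) :
    ∀ J ∈ L, J.IsBasicInd Ω ε := by
  obtain ⟨⟨hl, hr⟩, il, ir⟩ := hI
  cases h with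
  | dist_left C a b r hC hd =>
    rintro _ rfl
    exact ⟨⟨Branch.isBasic_plug hd.isBasic hl, hr⟩, Branch.ind_plug hC hd.ind il, ir⟩
  | dist_right C a b r hC hd =>
    rintro _ rfl
    exact ⟨⟨hl, Branch.isBasic_plug hd.isBasic hr⟩, il, Branch.ind_plug hC hd.ind ir⟩
  | elim_bot p =>
    rintro _ rfl
    exact ⟨⟨Form.IsBasic.subst (c := .bot) trivial hl, Form.IsBasic.subst (c := .bot) trivial hr⟩, il.subst rfl, ir.subst rfl⟩
  | elim_top p =>
    rintro _ rfl
    exact ⟨⟨Form.IsBasic.subst (c := .top) trivial hl, Form.IsBasic.subst (c := .top) trivial hr⟩, il.subst rfl, ir.subst rfl⟩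
  | split _ J K hs =>
    cases hs with
    | and_right a b c =>
      rintro _ (rfl | rfl)
      · exact ⟨⟨hl, hr.1⟩, il, ir.1⟩
      · exact ⟨⟨hl, hr.2⟩, il, ir.2⟩
    | or_left a b c =>
      rintro _ (rfl | rfl)
      · exact ⟨⟨hl.1, hr⟩, il.1, ir⟩
      · exact ⟨⟨hl.2, hr⟩, il.2, ir⟩

/-! ### Stage 1: termination -/

namespace Form

/-- A weight that decreases under the distribution rules for generation trees of sign `s`. -/
def weight : Sign → Form P N → ℕ
  -- Variables outweigh `bot` and `top`, so eliminating a variable that occurs lowers the weight.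
  -- The summand 1 at `+∨` and `-∧` pays for distribution: `2 * (x + y + 1)` exceeds `2 * x + 2 * y
  -- + 1`.
  | _, var _ => 3
  | _, nom _ => 2
  | _, bot => 2
  | _, top => 2
  | s, neg a => 2 * a.weight s.flip
  | .plus, and a b => a.weight .plus * b.weight .plus
  | .minus, and a b => a.weight .minus + b.weight .minus + 1
  | .plus, or a b => a.weight .plus + b.weight .plus + 1
  | .minus, or a b => a.weight .minus * b.weight .minus
  | s, imp a b => a.weight s.flip * b.weight s
  | s, box a => 2 * a.weight s
  | s, dia a => 2 * a.weight s
  | s, bdia a => 2 * a.weight s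
  | s, bbox a => 2 * a.weight s

/-- Positivity makes products strictly monotone in each factor; the bound 2 is what makes `(x + y +
1) * z` exceed `x * z + y * z + 1`. -/
theorem two_le_weight (s : Sign) (a : Form P N) : 2 ≤ a.weight s := by
  induction a generalizing s with
  | var | nom | bot | top => simp [weight]
  | neg a ih => have := ih s.flip; unfold weight; omega
  | box a ih | dia a ih | bdia a ih | bbox a ih => have := ih s; unfold weight; omega
  | and a b iha ihb | or a b iha ihb =>
    have ha := iha s
    have hb := ihb s
    cases s <;> unfold weight <;> nlinarith
  | imp a b iha ihb =>
    have ha := iha s.flip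
    have hb := ihb s
    unfold weight
    nlinarith

theorem _root_.ALBA.Distributes.weight_lt {s : Sign} {a b : Form P N} (h : Distributes s a b) :
    b.weight s < a.weight s := by
  cases h with
  | dia_or | neg_or | box_and | neg_and => simp only [weight, Sign.flip]; omega
  | or_and a b c | and_or a b c =>
    have := two_le_weight .plus c
    simp only [weight]
    nlinarith
  | or_imp a b c | and_or_left a b c | and_or_right a b c =>
    have := two_le_weight .minus c
    simp only [weight, Sign.flip]
    nlinarith
  | imp_and a b c =>
    have := two_le_weight .plus c
    simp only [weight, Sign.flip]
    nlinarith

/-- The weight is strictly increasing in each child at every node of either sign, so no Skeleton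
hypothesis is needed. -/
theorem _root_.ALBA.Branch.weight_plug_lt {C : Branch P N} {s : Sign} {a b : Form P N}
    (h : b.weight (C.endSign s) < a.weight (C.endSign s)) :
    (C.plug b).weight s < (C.plug a).weight s := by
  induction C generalizing s with
  | nil => exact h
  | cons f C ih =>
    have ih := ih h
    cases f with
    | neg | box | dia | bdia | bbox =>
      simp only [Branch.plug, Frame.app, weight, Frame.childSign] at ih ⊢
      omega
    | andL c | andR c | orL c | orR c | impR c =>
      have h1 := two_le_weight s c
      have h2 := two_le_weight s.flip c
      cases s <;> simp only [Branch.plug, Frame.app, weight, Frame.childSign, Sign.flip] at * <;>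
        nlinarith
    | impL c =>
      have h1 := two_le_weight s c
      simp only [Branch.plug, Frame.app, weight, Frame.childSign] at *
      nlinarith

theorem weight_subst_le {p : P} {c : Form P N} (hc : ∀ s, c.weight s = 2) (a : Form P N)
    (s : Sign) : (subst p c a).weight s ≤ a.weight s := by
  induction a generalizing s with
  | var q => unfold subst; split <;> simp [weight, hc]
  | nom | bot | top => exact le_rfl
  | neg a ih => exact Nat.mul_le_mul_left 2 (ih _)
  | box a ih | dia a ih | bdia a ih | bbox a ih => exact Nat.mul_le_mul_left 2 (ih s)
  | and a b iha ihb | or a b iha ihb =>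
    have ha := iha s
    have hb := ihb s
    cases s <;> simp only [subst, weight] <;> gcongr
  | imp a b iha ihb => exact Nat.mul_le_mul (iha _) (ihb _)

theorem weight_subst_lt {p : P} {c : Form P N} (hc : ∀ s, c.weight s = 2) (a : Form P N)
    (s : Sign) (hp : p ∈ a.vars) : (subst p c a).weight s < a.weight s := by
  induction a generalizing s with
  | var q =>
    obtain rfl : p = q := hp
    simp [subst, hc, weight]
  | nom | bot | top => exact hp.elim
  | neg a ih => exact Nat.mul_lt_mul_of_pos_left (ih _ hp) two_pos
  | box a ih | dia a ih | bdia a ih | bbox a ih =>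
    exact Nat.mul_lt_mul_of_pos_left (ih s hp) two_pos
  | and a b iha ihb | or a b iha ihb =>
    have ha := weight_subst_le hc a (p := p) s
    have hb := weight_subst_le hc b (p := p) s
    have ha2 := two_le_weight s (subst p c a)
    have hb2 := two_le_weight s (subst p c b)
    rcases hp with hp | hp
    · have := iha s hp
      cases s <;> simp only [subst, weight] <;> nlinarith
    · have := ihb s hp
      cases s <;> simp only [subst, weight] <;> nlinarith
  | imp a b iha ihb =>
    have ha := weight_subst_le hc a (p := p) s.flip
    have hb := weight_subst_le hc b (p := p) s
    have ha2 := two_le_weight s.flip (subst p c a)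
    have hb2 := two_le_weight s (subst p c b)
    rcases hp with hp | hp
    · have := iha s.flip hp
      simp only [subst, weight]
      nlinarith
    · have := ihb s hp
      simp only [subst, weight]
      nlinarith

end Form

/-- The weight of an inequality. -/
def Ineq.weight (I : Ineq P N) : ℕ := I.lhs.weight .plus * I.rhs.weight .minus

theorem Ineq.weight_subst_lt {p : P} {c : Form P N} (hc : ∀ s, c.weight s = 2) {I : Ineq P N}
    (hp : p ∈ I.vars) : (I.subst p c).weight < I.weight := by
  have hl := Form.weight_subst_le hc I.lhs (p := p) .plus
  have hr := Form.weight_subst_le hc I.rhs (p := p) .minus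
  have hl2 := Form.two_le_weight .plus (Form.subst p c I.lhs)
  have hr2 := Form.two_le_weight .minus (Form.subst p c I.rhs)
  simp only [Ineq.weight, Ineq.subst]
  rcases hp with hp | hp
  · have := Form.weight_subst_lt hc I.lhs .plus hp
    nlinarith
  · have := Form.weight_subst_lt hc I.rhs .minus hp
    nlinarith

open Classical in
-- The weights of the two sides are multiplied so that splitting decreases the sum as well: `(x + y
-- + 1) * z` exceeds `x * z + y * z`.
theorem Stage1Rule.weight_lt {I : Ineq P N} {L : Set (Ineq P N)} (h : Stage1Rule I L) :
    ∃ F : Finset (Ineq P N), (F : Set (Ineq P N)) = L ∧ ∑ J ∈ F, J.weight < I.weight := by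
  cases h with
  | dist_left C a b r hC hd =>
    refine ⟨{⟨C.plug b, r⟩}, by simp, ?_⟩
    have := Branch.weight_plug_lt hd.weight_lt
    have := Form.two_le_weight .minus r
    simp only [Finset.sum_singleton, Ineq.weight]
    gcongr
  | dist_right C a b l hC hd =>
    refine ⟨{⟨l, C.plug b⟩}, by simp, ?_⟩
    have := Branch.weight_plug_lt hd.weight_lt
    have := Form.two_le_weight .plus l
    simp only [Finset.sum_singleton, Ineq.weight]
    gcongr
  | elim_bot p _ hp =>
    exact ⟨{Ineq.subst p .bot I}, by simp, by
      simpa using Ineq.weight_subst_lt (fun s => by simp [Form.weight]) hp⟩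
  | elim_top p _ hp =>
    exact ⟨{Ineq.subst p .top I}, by simp, by
      simpa using Ineq.weight_subst_lt (fun s => by simp [Form.weight]) hp⟩
  | split _ J K hs =>
    refine ⟨{J, K}, by simp, ?_⟩
    -- The two parts may coincide, in which case the pair is a singleton.
    have h1 : ∑ M ∈ ({J, K} : Finset (Ineq P N)), M.weight ≤ J.weight + K.weight := by
      by_cases hJK : J = K
      · subst hJK; simp
      · rw [Finset.sum_pair hJK]
    refine h1.trans_lt ?_
    cases hs with
    | and_right a b c =>
      have := Form.two_le_weight .plus a
      simp only [Ineq.weight, Form.weight]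
      nlinarith
    | or_left a b c =>
      have := Form.two_le_weight .minus c
      simp only [Ineq.weight, Form.weight]
      nlinarith

open Classical in
theorem exists_stage1_normal_form (F : Finset (Ineq P N)) :
    ∃ X, Relation.ReflTransGen Stage1Step (F : Set (Ineq P N)) X ∧
      ∀ J ∈ X, ∀ L, ¬ Stage1Rule J L := by
  induction hn : ∑ J ∈ F, J.weight using Nat.strong_induction_on generalizing F with
  | _ n ih =>
    by_cases hF : ∀ J ∈ F, ∀ L, ¬ Stage1Rule J L
    · exact ⟨F, .refl, hF⟩
    push Not at hF
    obtain ⟨I, hI, L, hL⟩ := hF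
    obtain ⟨G, rfl, hG⟩ := hL.weight_lt
    -- The replacing inequalities may already be present; the overlap only lowers the total.
    have hlt : ∑ J ∈ F.erase I ∪ G, J.weight < n := by
      have h1 := Finset.sum_union_inter (s₁ := F.erase I) (s₂ := G) (f := Ineq.weight)
      have h2 := Finset.add_sum_erase F Ineq.weight hI
      omega
    obtain ⟨X, hX, hX'⟩ := ih _ hlt _ rfl
    exact ⟨X, .head ⟨I, hI, _, hL, by simp⟩ hX, hX'⟩

theorem exists_stage1Result (I : Ineq P N) : ∃ X, Stage1Result I X := by
  simpa [Stage1Result] using exists_stage1_normal_form {I}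

theorem Stage1Result.finite_and_isBasicInd {Ω : P → P → Prop} {ε : P → Sign} {I : Ineq P N}
    {X : Set (Ineq P N)} (h : Stage1Result I X) (hI : I.IsBasicInd Ω ε) :
    X.Finite ∧ ∀ J ∈ X, J.IsBasicInd Ω ε := by
  obtain ⟨h, -⟩ := h
  induction h with
  | refl => exact ⟨Set.finite_singleton I, by rintro _ rfl; exact hI⟩
  | tail _ hs ih =>
    obtain ⟨J, hJ, L, hL, rfl⟩ := hs
    obtain ⟨F, rfl, -⟩ := hL.weight_lt
    refine ⟨ih.1.sdiff.union F.finite_toSet, ?_⟩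
    rintro K (hK | hK)
    · exact ih.2 K hK.1
    · exact hL.isBasicInd (ih.2 J hJ) K hK

/-! ### Stage 1: shape of the normal forms -/

namespace Form

variable {Ω : P → P → Prop} {ε : P → Sign}

/-- An SLR part, starting at the root, on top of trees that are neither `+∨` nor `-∧` at the root
and all of whose critical branches consist of PIA nodes. -/
def Definite (Ω : P → P → Prop) (ε : P → Sign) : Sign → Form P N → Prop
  | _, var _ => True
  | _, nom _ => True
  | _, bot => True
  | _, top => True
  | s, neg a => a.Definite Ω ε s.flip
  | .plus, and a b => a.Definite Ω ε .plus ∧ b.Definite Ω ε .plus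
  | .minus, and _ _ => False
  | .plus, or _ _ => False
  | .minus, or a b => a.Definite Ω ε .minus ∧ b.Definite Ω ε .minus
  | .plus, imp a b => (imp a b).Pia Ω ε .plus
  | .minus, imp a b => a.Definite Ω ε .plus ∧ b.Definite Ω ε .minus
  | .plus, box a => (box a).Pia Ω ε .plus
  | .minus, box a => a.Definite Ω ε .minus
  | .plus, dia a => a.Definite Ω ε .plus
  | .minus, dia a => (dia a).Pia Ω ε .minus
  | s, bdia a => (bdia a).Pia Ω ε s
  | s, bbox a => (bbox a).Pia Ω ε s

/-- No distribution rule is applicable to `s a`. -/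
def NoDistribution (s : Sign) (a : Form P N) : Prop :=
  ∀ (C : Branch P N) (x y : Form P N), C.AllSkeleton s → C.plug x = a →
    ¬ Distributes (C.endSign s) x y

theorem NoDistribution.root {s : Sign} {a b : Form P N} (h : NoDistribution s a) :
    ¬ Distributes s a b :=
  h [] a b (by simp [Branch.AllSkeleton, Branch.nodes]) rfl

theorem NoDistribution.child {s : Sign} {f : Frame P N} {a : Form P N}
    (h : NoDistribution s (f.app a)) (hf : f.IsSLR s) : NoDistribution (f.childSign s) a :=
  fun C x y hC hx => h (f :: C) x y (Branch.allSkeleton_cons.mpr ⟨.inr hf, hC⟩)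
    (by simp [Branch.plug, hx])

/-- The root of `s a` is `+∨` or `-∧`. -/
def IsJoin : Sign → Form P N → Prop
  | .plus, or _ _ => True
  | .minus, and _ _ => True
  | _, _ => False

theorem isJoin_plus {a : Form P N} (h : a.IsJoin .plus) : ∃ b c, a = or b c := by
  cases a <;> simp_all [IsJoin]

theorem isJoin_minus {a : Form P N} (h : a.IsJoin .minus) : ∃ b c, a = and b c := by
  cases a <;> simp_all [IsJoin]

/-- Every SLR node immediately above a `+∨` or `-∧` is a redex of some distribution rule. -/
theorem NoDistribution.not_isJoin {s : Sign} {f : Frame P N} {a : Form P N}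
    (h : NoDistribution s (f.app a)) (hf : f.IsSLR s) : ¬ a.IsJoin (f.childSign s) := by
  intro hj
  cases s <;> cases f <;> first | exact hf | skip
  all_goals
    first
    | obtain ⟨b, c, rfl⟩ := isJoin_plus hj
    | obtain ⟨b, c, rfl⟩ := isJoin_minus hj
    exact h.root (by constructor)

/-- The Skeleton nodes other than `+∨` and `-∧` are exactly the SLR nodes. Descending through SLR
nodes never meets a `+∨` or `-∧`, so the descent stops only at a leaf or at a node that is not
Skeleton, where `Ind` is already `Pia`. -/
theorem Ind.definite {s : Sign} {a : Form P N} (h : a.Ind Ω ε s) (hd : NoDistribution s a)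
    (hj : ¬ a.IsJoin s) : a.Definite Ω ε s := by
  have key : ∀ {a : Form P N} {s : Sign} (f : Frame P N) (b : Form P N), a = f.app b →
      NoDistribution s a → f.IsSLR s → b.Ind Ω ε (f.childSign s) →
      (∀ {t : Sign}, b.Ind Ω ε t → NoDistribution t b → ¬ b.IsJoin t → b.Definite Ω ε t) →
      b.Definite Ω ε (f.childSign s) := by
    rintro _ s f b rfl hd hf hb ih
    exact ih hb (hd.child hf) (hd.not_isJoin hf)
  induction a generalizing s with
  | var | nom | bot | top => simp [Definite]
  | neg a ih => exact key .neg a rfl hd (by cases s <;> trivial) h ih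
  | and a b iha ihb =>
    cases s with
    | plus => exact ⟨key (.andL b) a rfl hd trivial h.1 iha, key (.andR a) b rfl hd trivial h.2 ihb⟩
    | minus => exact hj trivial
  | or a b iha ihb =>
    cases s with
    | minus => exact ⟨key (.orL b) a rfl hd trivial h.1 iha, key (.orR a) b rfl hd trivial h.2 ihb⟩
    | plus => exact hj trivial
  | imp a b iha ihb =>
    cases s with
    | minus =>
      exact ⟨key (.impL b) a rfl hd trivial h.1 iha, key (.impR a) b rfl hd trivial h.2 ihb⟩
    | plus => exact h
  | box a ih =>
    cases s with
    | minus => exact key .box a rfl hd trivial h ih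
    | plus => exact h
  | dia a ih =>
    cases s with
    | plus => exact key .dia a rfl hd trivial h ih
    | minus => exact h
  | bdia a ih | bbox a ih => cases s <;> exact h

end Form

theorem Ineq.IsBasicInd.definite {Ω : P → P → Prop} {ε : P → Sign} {I : Ineq P N}
    (hI : I.IsBasicInd Ω ε) (h : ∀ L, ¬ Stage1Rule I L) :
    I.lhs.Definite Ω ε .plus ∧ I.rhs.Definite Ω ε .minus := by
  obtain ⟨l, r⟩ := I
  refine ⟨hI.2.1.definite ?_ ?_, hI.2.2.definite ?_ ?_⟩
  · rintro C x y hC rfl hd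
    exact h _ (.dist_left C x y r hC hd)
  · intro hj
    obtain ⟨b, c, rfl⟩ := Form.isJoin_plus hj
    exact h _ (.split _ _ _ (.or_left b c r))
  · rintro C x y hC rfl hd
    exact h _ (.dist_right C x y l hC hd)
  · intro hj
    obtain ⟨b, c, rfl⟩ := Form.isJoin_minus hj
    exact h _ (.split _ _ _ (.and_right l b c))

end

end ALBA

namespace ALBA

section

variable {P : Type*} {N : Type*}

/-! ### Stage 2: approximation -/

/-- The inequality between `a` and `c` in which `c` stands on the right for the sign `plus` and on
the left for the sign `minus`. -/
def Ineq.ofSign : Sign → Form P N → Form P N → Ineq P N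
  | .plus, a, c => ⟨a, c⟩
  | .minus, a, c => ⟨c, a⟩

/-- The formula that approximates a subformula of the given sign. -/
def Form.ofNom : Sign → N → Form P N
  | .plus, i => .nom i
  | .minus, i => .neg (.nom i)

theorem Form.vars_ofNom (s : Sign) (i : N) : (Form.ofNom s i : Form P N).vars = ∅ := by
  cases s <;> rfl

theorem Form.finite_noms (a : Form P N) : a.noms.Finite := by
  induction a <;> simp_all [Form.noms]

theorem Ineq.finite_noms (I : Ineq P N) : I.noms.Finite :=
  I.lhs.finite_noms.union I.rhs.finite_noms

theorem ASystem.exists_fresh [Infinite N] {S : Set (Ineq P N)} (hS : S.Finite) (E : Ineq P N) :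
    ∃ i : N, ASystem.Fresh i ⟨S, E⟩ := by
  obtain ⟨i, hi⟩ := ((hS.biUnion fun J _ => J.finite_noms).union E.finite_noms).exists_notMem
  simp only [Set.mem_union, Set.mem_iUnion, not_or, not_exists] at hi
  exact ⟨i, hi.1, hi.2⟩

theorem Stage2Step.approx {S : Set (Ineq P N)} {C : Branch P N} {s t : Sign} {c r : Form P N}
    {i : N} (ht : C.endSign s = t) (hC : MaximalSLR C s c) (hc : c.IsBasic)
    (hi : ASystem.Fresh i ⟨S, Ineq.ofSign s (C.plug c) r⟩) :
    Stage2Step ⟨S, Ineq.ofSign s (C.plug c) r⟩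
      ⟨S ∪ {Ineq.ofSign t (Form.ofNom t i) c}, Ineq.ofSign s (C.plug (Form.ofNom t i)) r⟩ := by
  cases s <;> cases t
  · exact .approx_left_pos S C c r i ht hC hc hi
  · exact .approx_left_neg S C c r i ht hC hc hi
  · exact .approx_right_pos S C c r i ht hC hc hi
  · exact .approx_right_neg S C c r i ht hC hc hi

namespace Branch

theorem plug_append (C D : Branch P N) (a : Form P N) : plug (C ++ D) a = C.plug (D.plug a) := by
  induction C with
  | nil => rfl
  | cons f C ih => simp [plug, ih]

theorem endSign_append (C D : Branch P N) (s : Sign) :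
    endSign (C ++ D) s = D.endSign (C.endSign s) := by
  induction C generalizing s with
  | nil => rfl
  | cons f C ih => simp [endSign, ih]

theorem AllSLR.append_singleton {C : Branch P N} {s : Sign} (hC : C.AllSLR s) {f : Frame P N}
    (hf : f.IsSLR (C.endSign s)) : AllSLR (C ++ [f]) s := by
  induction C generalizing s with
  | nil => simpa [AllSLR, nodes, endSign] using hf
  | cons g C ih =>
    have h := List.forall_mem_cons.mp hC
    exact List.forall_mem_cons.mpr ⟨h.1, ih h.2 hf⟩

end Branch

variable {Ω : P → P → Prop} {ε : P → Sign}

/-- The inequalities that the approximation rules produce from definite trees. -/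
def Ineq.IsApproximation (Ω : P → P → Prop) (ε : P → Sign) (J : Ineq P N) : Prop :=
  ∃ s i c, J = Ineq.ofSign s (Form.ofNom s i) c ∧ c.Pia Ω ε s

/-- All subformulas at maximal SLR positions of `a`, standing at the end of a branch of sign `t`,
can be replaced by formulas without variables. -/
def Form.Approximable (Ω : P → P → Prop) (ε : P → Sign) (t : Sign) (a : Form P N) : Prop :=
  ∀ (s : Sign) (C : Branch P N), C.AllSLR s → C.endSign s = t → ∀ (r : Form P N)
    (S : Set (Ineq P N)), S.Finite → (∀ J ∈ S, J.IsApproximation Ω ε) →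
    ∃ S' a', S'.Finite ∧ (∀ J ∈ S', J.IsApproximation Ω ε) ∧ a'.vars = ∅ ∧
      Relation.ReflTransGen Stage2Step ⟨S, Ineq.ofSign s (C.plug a) r⟩
        ⟨S', Ineq.ofSign s (C.plug a') r⟩

namespace Form

/-- The base case: the node is not SLR, so approximation here is pivotal, and one step with a fresh
nominal suffices. -/
theorem Approximable.of_pia [Infinite N] {t : Sign} {a : Form P N} (ha : a.IsBasic)
    (hp : a.Pia Ω ε t) (hf : ∀ (f : Frame P N) (d : Form P N), a = f.app d → ¬ f.IsSLR t) :
    a.Approximable Ω ε t := by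
  rintro s C hC rfl r S hS hS'
  obtain ⟨i, hi⟩ := ASystem.exists_fresh hS (Ineq.ofSign s (C.plug a) r)
  refine ⟨_, _, hS.union (Set.finite_singleton _), ?_, vars_ofNom _ i,
    .single (.approx rfl ⟨hC, hf⟩ ha hi)⟩
  rintro J (hJ | rfl)
  · exact hS' J hJ
  · exact ⟨_, i, a, rfl, hp⟩

theorem Approximable.unary {t : Sign} {a : Form P N} (f : Frame P N) (hf : f.IsSLR t)
    (hv : ∀ b : Form P N, (f.app b).vars = b.vars) (ha : a.Approximable Ω ε (f.childSign t)) :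
    (f.app a).Approximable Ω ε t := by
  rintro s C hC rfl r S hS hS'
  obtain ⟨S', a', h1, h2, h3, h4⟩ := ha s (C ++ [f]) (hC.append_singleton hf)
    (by simp [Branch.endSign_append, Branch.endSign]) r S hS hS'
  exact ⟨S', f.app a', h1, h2, by rw [hv, h3],
    by simpa [Branch.plug_append, Branch.plug] using h4⟩

theorem Approximable.binary {t : Sign} {a b : Form P N} (op : Form P N → Form P N → Form P N)
    (f g : Form P N → Frame P N) (hfop : ∀ x y, (f y).app x = op x y)
    (hgop : ∀ x y, (g x).app y = op x y) (hf : ∀ y, (f y).IsSLR t) (hg : ∀ x, (g x).IsSLR t)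
    (hv : ∀ x y : Form P N, (op x y).vars = x.vars ∪ y.vars) {u v : Sign}
    (hu : ∀ y, (f y).childSign t = u) (hw : ∀ x, (g x).childSign t = v)
    (ha : a.Approximable Ω ε u) (hb : b.Approximable Ω ε v) :
    (op a b).Approximable Ω ε t := by
  rintro s C hC rfl r S hS hS'
  obtain ⟨S₁, a', h1, h2, h3, h4⟩ := ha s (C ++ [f b]) (hC.append_singleton (hf b))
    (by simp [Branch.endSign_append, Branch.endSign, hu]) r S hS hS'
  -- The right child is treated after the left one, so the context now holds `a'` as sibling.
  obtain ⟨S₂, b', k1, k2, k3, k4⟩ := hb s (C ++ [g a']) (hC.append_singleton (hg a'))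
    (by simp [Branch.endSign_append, Branch.endSign, hw]) r S₁ h1 h2
  simp only [Branch.plug_append, Branch.plug, hfop, hgop] at h4 k4
  exact ⟨S₂, op a' b', k1, k2, by simp [hv, h3, k3], h4.trans k4⟩

theorem Definite.approximable [Infinite N] {t : Sign} {a : Form P N} (h : a.Definite Ω ε t)
    (ha : a.IsBasic) : a.Approximable Ω ε t := by
  induction a generalizing t with
  | nom | bdia | bbox => exact ha.elim
  | var | bot | top =>
    refine .of_pia ha (by simp [Pia]) ?_
    rintro (_ | _) d hd <;> simp [Frame.app] at hd
  | neg a ih => exact .unary .neg (by cases t <;> trivial) (fun _ => rfl) (ih h ha)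
  | and a b iha ihb =>
    cases t with
    | plus =>
      exact .binary .and .andL .andR (fun _ _ => rfl) (fun _ _ => rfl) (fun _ => trivial)
        (fun _ => trivial) (fun _ _ => rfl) (fun _ => rfl) (fun _ => rfl) (iha h.1 ha.1)
        (ihb h.2 ha.2)
    | minus => exact h.elim
  | or a b iha ihb =>
    cases t with
    | minus =>
      exact .binary .or .orL .orR (fun _ _ => rfl) (fun _ _ => rfl) (fun _ => trivial)
        (fun _ => trivial) (fun _ _ => rfl) (fun _ => rfl) (fun _ => rfl) (iha h.1 ha.1)
        (ihb h.2 ha.2)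
    | plus => exact h.elim
  | imp a b iha ihb =>
    cases t with
    | minus =>
      exact .binary .imp .impL .impR (fun _ _ => rfl) (fun _ _ => rfl) (fun _ => trivial)
        (fun _ => trivial) (fun _ _ => rfl) (fun _ => rfl) (fun _ => rfl) (iha h.1 ha.1)
        (ihb h.2 ha.2)
    | plus =>
      refine .of_pia ha h ?_
      rintro (_ | _) d hd <;> simp [Frame.app, Frame.IsSLR] at hd ⊢
  | box a ih =>
    cases t with
    | minus => exact .unary .box trivial (fun _ => rfl) (ih h ha)
    | plus =>
      refine .of_pia ha h ?_
      rintro (_ | _) d hd <;> simp [Frame.app, Frame.IsSLR] at hd ⊢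
  | dia a ih =>
    cases t with
    | plus => exact .unary .dia trivial (fun _ => rfl) (ih h ha)
    | minus =>
      refine .of_pia ha h ?_
      rintro (_ | _) d hd <;> simp [Frame.app, Frame.IsSLR] at hd ⊢

end Form

theorem Ineq.exists_approximation [Infinite N] {I : Ineq P N} (hI : I.IsBasic)
    (hl : I.lhs.Definite Ω ε .plus) (hr : I.rhs.Definite Ω ε .minus) :
    ∃ (S : Set (Ineq P N)) (E : Ineq P N), S.Finite ∧ (∀ J ∈ S, J.IsApproximation Ω ε) ∧
      E.IsPure ∧ Relation.ReflTransGen Stage2Step ⟨∅, I⟩ ⟨S, E⟩ := by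
  obtain ⟨S, a, h1, h2, h3, h4⟩ := hl.approximable hI.1 .plus []
    (by simp [Branch.AllSLR, Branch.nodes]) rfl I.rhs ∅ Set.finite_empty (by simp)
  obtain ⟨S', b, k1, k2, k3, k4⟩ := hr.approximable hI.2 .minus []
    (by simp [Branch.AllSLR, Branch.nodes]) rfl a S h1 h2
  exact ⟨S', ⟨a, b⟩, k1, k2, by simp [Ineq.IsPure, Ineq.vars, h3, k3], h4.trans k4⟩

/-! ### Stage 2: residuation and splitting -/

/-- The leaves of the inequality, with the left-hand side signed `-` and the right-hand side
signed `+`. -/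
def Ineq.leaves (I : Ineq P N) : Set (Sign × P) := I.lhs.leaves .minus ∪ I.rhs.leaves .plus

theorem Ineq.leaves_ofSign (s : Sign) (a c : Form P N) :
    (Ineq.ofSign s a c).leaves = a.leaves s.flip ∪ c.leaves s := by
  cases s
  · rfl
  · exact Set.union_comm _ _

theorem Ineq.vars_ofSign (s : Sign) (a c : Form P N) :
    (Ineq.ofSign s a c).vars = a.vars ∪ c.vars := by
  cases s
  · rfl
  · exact Set.union_comm _ _

/-- Inequalities in the shape required by the Ackermann rules: either without critical leaves,
or bounding a variable by a formula without critical leaves whose variables are `Ω`-smaller. -/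
def Ineq.IsSolved (Ω : P → P → Prop) (ε : P → Sign) (J : Ineq P N) : Prop :=
  (∀ p, (ε p, p) ∉ J.leaves) ∨
    ∃ p a, J = Ineq.ofSign (ε p) a (.var p) ∧ a.NonCritical ε (ε p).flip ∧ ∀ q ∈ a.vars, Ω q p

/-- As a member of any finite system, `I` can be replaced by solved inequalities. -/
def Ineq.IsSolvable (Ω : P → P → Prop) (ε : P → Sign) (I : Ineq P N) : Prop :=
  ∀ (S : Set (Ineq P N)) (E : Ineq P N), S.Finite → I ∈ S →
    ∃ S', Relation.ReflTransGen Stage2Step ⟨S, E⟩ ⟨S', E⟩ ∧ S'.Finite ∧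
      S' ⊆ S \ {I} ∪ {J | J.IsSolved Ω ε}

theorem Ineq.IsSolved.isSolvable {I : Ineq P N} (h : I.IsSolved Ω ε) : I.IsSolvable Ω ε := by
  refine fun S E hS _ => ⟨S, .refl, hS, fun J hJ => ?_⟩
  by_cases hJI : J = I
  · exact .inr (hJI ▸ h)
  · exact .inl ⟨hJ, hJI⟩

theorem Residuates.isSolvable {I J : Ineq P N} (h : Residuates I J) (hJ : J.IsSolvable Ω ε) :
    I.IsSolvable Ω ε := by
  intro S E hS hI
  obtain ⟨S', h1, h2, h3⟩ := hJ (S \ {I} ∪ {J}) E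
    (hS.sdiff.union (Set.finite_singleton J)) (.inr rfl)
  refine ⟨S', .head (.residuation S E I J hI h) h1, h2, fun K hK => ?_⟩
  rcases h3 hK with ⟨hK | hK, hKJ⟩ | hK
  · exact .inl hK
  · exact absurd hK hKJ
  · exact .inr hK

theorem Splits.isSolvable {I J K : Ineq P N} (h : Splits I J K) (hJ : J.IsSolvable Ω ε)
    (hK : K.IsSolvable Ω ε) : I.IsSolvable Ω ε := by
  intro S E hS hI
  obtain ⟨S₁, h1, h2, h3⟩ := hJ (S \ {I} ∪ {J, K}) E
    (hS.sdiff.union (Set.toFinite _)) (.inr (.inl rfl))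
  -- Apart from `K`, all that remains after treating `J` is old or solved. Whether `K` is still
  -- there has to be asked, since it may equal `J` or have been rewritten on the way.
  have h3' : S₁ \ {K} ⊆ S \ {I} ∪ {J | J.IsSolved Ω ε} := by
    rintro M ⟨hM, hMK⟩
    rcases h3 hM with ⟨hM | hM | hM, hMJ⟩ | hM
    · exact .inl hM
    · exact absurd hM hMJ
    · exact absurd hM hMK
    · exact .inr hM
  have step := Stage2Step.splitting S E I J K hI h
  by_cases hKS : K ∈ S₁
  · obtain ⟨S₂, k1, k2, k3⟩ := hK S₁ E h2 hKS
    exact ⟨S₂, .head step (h1.trans k1), k2,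
      k3.trans (Set.union_subset h3' Set.subset_union_right)⟩
  · exact ⟨S₁, .head step h1, h2, by rwa [Set.sdiff_singleton_eq_self hKS] at h3'⟩

namespace Form

theorem isSolvable_of_nonCritical {s : Sign} {a c : Form P N} (ha : a.NonCritical ε s.flip)
    (hc : c.NonCritical ε s) : (Ineq.ofSign s a c).IsSolvable Ω ε := by
  refine Ineq.IsSolved.isSolvable (.inl fun p hp => ?_)
  rw [Ineq.leaves_ofSign] at hp
  exact hp.elim (ha p) (hc p)

theorem NonCritical.union {s t : Sign} {a b c : Form P N} {u : Sign}
    (ha : a.NonCritical ε s) (hb : b.NonCritical ε t)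
    (hc : c.leaves u = a.leaves s ∪ b.leaves t) : c.NonCritical ε u := by
  intro p hp
  rw [hc] at hp
  exact hp.elim (ha p) (hb p)

/-- The variables of `a` are `Ω`-below the critical variables of `s c`. -/
def Below (Ω : P → P → Prop) (ε : P → Sign) (s : Sign) (c a : Form P N) : Prop :=
  ∀ p, (ε p, p) ∈ c.leaves s → ∀ q ∈ a.vars, Ω q p

/-- Solvability at an SRR node: the side `b` moves to the other side of the inequality, provided
that it is not critical. -/
theorem isSolvable_srr {s t u : Sign} {a b c α d e : Form P N}
    (hc : c.leaves s = a.leaves t ∪ b.leaves u)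
    (hd : d.leaves t.flip = α.leaves s.flip ∪ b.leaves u)
    (he : e.leaves u.flip = α.leaves s.flip ∪ a.leaves t)
    (hdv : d.vars = α.vars ∪ b.vars) (hev : e.vars = α.vars ∪ a.vars)
    (hIJ : Residuates (Ineq.ofSign s α c) (Ineq.ofSign t d a))
    (hIK : Residuates (Ineq.ofSign s α c) (Ineq.ofSign u e b))
    (hab : SideCondition Ω ε t a u b) (hba : SideCondition Ω ε u b t a)
    (hα : α.NonCritical ε s.flip) (hb : Below Ω ε s c α)
    (iha : ∀ β : Form P N, β.NonCritical ε t.flip → Below Ω ε t a β →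
      (Ineq.ofSign t β a).IsSolvable Ω ε)
    (ihb : ∀ β : Form P N, β.NonCritical ε u.flip → Below Ω ε u b β →
      (Ineq.ofSign u β b).IsSolvable Ω ε) :
    (Ineq.ofSign s α c).IsSolvable Ω ε := by
  by_cases hac : a.NonCritical ε t
  · by_cases hbc : b.NonCritical ε u
    · exact isSolvable_of_nonCritical hα (hac.union hbc hc)
    · refine hIK.isSolvable (ihb e (hα.union hac he) fun p hp q hq => ?_)
      rw [hev] at hq
      rcases hq with hq | hq
      · exact hb p (by rw [hc]; exact .inr hp) q hq
      · exact (hba p hp).2 q hq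
  -- A critical leaf in `a` forces `b` to be non-critical by the side condition, so `b` may join
  -- `α`; its variables lie `Ω`-below every critical variable of `a`.
  · obtain ⟨p₀, hp₀⟩ : ∃ p, (ε p, p) ∈ a.leaves t := by simpa [NonCritical] using hac
    refine hIJ.isSolvable (iha d (hα.union (hab p₀ hp₀).1 hd) fun p hp q hq => ?_)
    rw [hdv] at hq
    rcases hq with hq | hq
    · exact hb p (by rw [hc]; exact .inl hp) q hq
    · exact (hab p hp).2 q hq

/-- Induction on the PIA tree with `α` arbitrary, since `α` collects what residuation moves across.
The two hypotheses on `α` are the invariant, and at a critical leaf they become the definition of a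
solved bound. -/
theorem Pia.isSolvable {s : Sign} {c : Form P N} (hc : c.Pia Ω ε s) {α : Form P N}
    (hα : α.NonCritical ε s.flip) (hb : Below Ω ε s c α) :
    (Ineq.ofSign s α c).IsSolvable Ω ε := by
  induction c generalizing s α with
  | var q =>
    by_cases hq : s = ε q
    · subst hq
      exact Ineq.IsSolved.isSolvable (.inr ⟨q, α, rfl, hα, hb q rfl⟩)
    · refine isSolvable_of_nonCritical hα ?_
      intro p hp
      obtain ⟨h1, rfl⟩ := Prod.mk.inj (Set.mem_singleton_iff.mp hp)
      exact hq h1.symm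
  | nom | bot | top => exact isSolvable_of_nonCritical hα fun p hp => hp
  | neg a ih =>
    have := ih (s := s.flip) (α := neg α) hc (by simpa [NonCritical, leaves] using hα) hb
    cases s
    · exact (Residuates.neg_right α a).isSolvable this
    · exact (Residuates.neg_left a α).isSolvable this
  | and a b iha ihb =>
    cases s with
    | plus =>
      exact (Splits.and_right α a b).isSolvable
        (iha hc.1 hα fun p hp => hb p (.inl hp)) (ihb hc.2 hα fun p hp => hb p (.inr hp))
    | minus =>
      exact isSolvable_srr (s := .minus) (t := .minus) (u := .minus) rfl
        (Set.union_comm _ _) (Set.union_comm _ _) (Set.union_comm _ _) (Set.union_comm _ _)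
        (Residuates.and_one a b α) (Residuates.and_two a b α) hc.2.2.1 hc.2.2.2 hα hb
        (fun _ h h' => iha hc.1 h h') (fun _ h h' => ihb hc.2.1 h h')
  | or a b iha ihb =>
    cases s with
    | minus =>
      exact (Splits.or_left a b α).isSolvable
        (iha hc.1 hα fun p hp => hb p (.inl hp)) (ihb hc.2 hα fun p hp => hb p (.inr hp))
    | plus =>
      exact isSolvable_srr (s := .plus) (t := .plus) (u := .plus) rfl
        rfl rfl rfl rfl
        (Residuates.or_two α a b) (Residuates.or_one α a b) hc.2.2.1 hc.2.2.2 hα hb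
        (fun _ h h' => iha hc.1 h h') (fun _ h h' => ihb hc.2.1 h h')
  | imp a b iha ihb =>
    cases s with
    | plus =>
      exact isSolvable_srr (s := .plus) (t := .minus) (u := .plus) rfl
        rfl rfl rfl rfl
        (Residuates.imp_two α a b) (Residuates.imp_one α a b) hc.2.2.1 hc.2.2.2 hα hb
        (fun _ h h' => iha hc.1 h h') (fun _ h h' => ihb hc.2.1 h h')
    | minus => exact isSolvable_of_nonCritical hα (hc.1.union hc.2 rfl)
  | box a ih =>
    cases s with
    | plus => exact (Residuates.box α a).isSolvable (ih (s := .plus) (α := bdia α) hc hα hb)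
    | minus => exact isSolvable_of_nonCritical hα hc
  | dia a ih =>
    cases s with
    | minus => exact (Residuates.dia a α).isSolvable (ih (s := .minus) (α := bbox α) hc hα hb)
    | plus => exact isSolvable_of_nonCritical hα hc
  | bdia a ih => cases s <;> exact isSolvable_of_nonCritical hα hc
  | bbox a ih => cases s <;> exact isSolvable_of_nonCritical hα hc

end Form

theorem Ineq.IsApproximation.isSolvable {J : Ineq P N} (h : J.IsApproximation Ω ε) :
    J.IsSolvable Ω ε := by
  obtain ⟨s, i, c, rfl, hc⟩ := h
  refine hc.isSolvable (fun p hp => ?_) fun p _ q hq => ?_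
  · rwa [Form.leaves_eq_empty_of_vars (Form.vars_ofNom s i)] at hp
  · rw [Form.vars_ofNom] at hq
    exact hq.elim

/-- Solving one member adds only solved inequalities, so the number of unsolved ones strictly
decreases. -/
theorem exists_solved {S : Set (Ineq P N)} (hS : S.Finite) (h : ∀ J ∈ S, J.IsSolvable Ω ε)
    (E : Ineq P N) :
    ∃ S' : Set (Ineq P N), Relation.ReflTransGen Stage2Step ⟨S, E⟩ ⟨S', E⟩ ∧ S'.Finite ∧
      ∀ J ∈ S', J.IsSolved Ω ε := by
  induction hn : (S \ {J | J.IsSolved Ω ε}).ncard using Nat.strong_induction_on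
    generalizing S with
  | _ n ih =>
    by_cases hS' : ∀ J ∈ S, J.IsSolved Ω ε
    · exact ⟨S, .refl, hS, hS'⟩
    push Not at hS'
    obtain ⟨I, hI, hIs⟩ := hS'
    obtain ⟨S₁, h1, h2, h3⟩ := h I hI S E hS hI
    have hlt : (S₁ \ {J | J.IsSolved Ω ε}).ncard < n := by
      rw [← hn]
      refine Set.ncard_lt_ncard ⟨fun J hJ => ?_, fun hle => ?_⟩ hS.sdiff
      · rcases h3 hJ.1 with hJ' | hJ'
        · exact ⟨hJ'.1, hJ.2⟩
        · exact absurd hJ' hJ.2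
      · rcases h3 (hle ⟨hI, hIs⟩).1 with hI' | hI'
        · exact hI'.2 rfl
        · exact hIs hI'
    obtain ⟨S₂, k1, k2, k3⟩ := ih _ hlt h2
      (fun J hJ => (h3 hJ).elim (fun hJ => h J hJ.1) fun hJ => Ineq.IsSolved.isSolvable hJ) rfl
    exact ⟨S₂, h1.trans k1, k2, k3⟩

end

end ALBA

namespace ALBA

section

variable {P : Type*} {N : Type*} {Ω : P → P → Prop} {ε : P → Sign}

/-! ### Stage 2: the Ackermann rules -/

namespace Form

/-- A leaf is either an old one or lies in a copy of `c`, whose root inherits the sign `u` of the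
occurrence of `p` that it replaces. -/
theorem mem_leaves_subst {p : P} {c a : Form P N} {s : Sign} {l : Sign × P}
    (h : l ∈ (subst p c a).leaves s) :
    (l ∈ a.leaves s ∧ l.2 ≠ p) ∨ ∃ u, (u, p) ∈ a.leaves s ∧ l ∈ c.leaves u := by
  induction a generalizing s with
  | var q =>
    unfold subst at h
    split at h
    · rename_i hq
      subst hq
      exact .inr ⟨s, rfl, h⟩
    · rename_i hq
      obtain rfl : l = (s, q) := h
      exact .inl ⟨rfl, hq⟩
  | nom | bot | top => exact h.elim
  | neg a ih => exact ih h
  | box a ih | dia a ih | bdia a ih | bbox a ih => exact ih (s := s) h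
  | and a b iha ihb | or a b iha ihb | imp a b iha ihb =>
    rcases h with h | h
    · rcases iha h with h | ⟨u, h, h'⟩
      · exact .inl ⟨.inl h.1, h.2⟩
      · exact .inr ⟨u, .inl h, h'⟩
    · rcases ihb h with h | ⟨u, h, h'⟩
      · exact .inl ⟨.inr h.1, h.2⟩
      · exact .inr ⟨u, .inr h, h'⟩

theorem mem_vars_subst {p q : P} {c a : Form P N} (h : q ∈ (subst p c a).vars) :
    (q ∈ a.vars ∧ q ≠ p) ∨ (p ∈ a.vars ∧ q ∈ c.vars) := by
  induction a with
  | var r =>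
    unfold subst at h
    split at h
    · rename_i hr
      exact .inr ⟨hr.symm, h⟩
    · rename_i hr
      obtain rfl : q = r := h
      exact .inl ⟨rfl, hr⟩
  | nom | bot | top => exact h.elim
  | neg a ih | box a ih | dia a ih | bdia a ih | bbox a ih => exact ih h
  | and a b iha ihb | or a b iha ihb | imp a b iha ihb =>
    rcases h with h | h
    · exact (iha h).imp (.imp_left .inl) (.imp_left .inl)
    · exact (ihb h).imp (.imp_left .inr) (.imp_left .inr)

theorem mem_leaves_flip {a : Form P N} {s t : Sign} {p : P} :
    (t.flip, p) ∈ a.leaves s.flip ↔ (t, p) ∈ a.leaves s := by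
  induction a generalizing s with
  | var q => cases s <;> cases t <;> simp [leaves, Sign.flip]
  | nom | bot | top => exact Iff.rfl
  | neg a ih => exact ih
  | box a ih | dia a ih | bdia a ih | bbox a ih => exact ih (s := s)
  | and a b iha ihb | or a b iha ihb | imp a b iha ihb => exact or_congr iha ihb

/-- Finite disjunction for the sign `plus`, finite conjunction for `minus`. -/
def bigOfSign : Sign → List (Form P N) → Form P N
  | .plus => bigOr
  | .minus => bigAnd

theorem exists_mem_leaves_of_bigOfSign {t s : Sign} {l : Sign × P} {as : List (Form P N)}
    (h : l ∈ (bigOfSign t as).leaves s) : ∃ a ∈ as, l ∈ a.leaves s := by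
  cases t <;>
  · induction as with
    | nil => exact h.elim
    | cons a as ih =>
      cases as with
      | nil => exact ⟨a, by simp, h⟩
      | cons b as =>
        rcases h with h | h
        · exact ⟨a, by simp, h⟩
        · obtain ⟨c, hc, hl⟩ := ih h
          exact ⟨c, List.mem_cons_of_mem _ hc, hl⟩

theorem exists_mem_vars_of_bigOfSign {t : Sign} {q : P} {as : List (Form P N)}
    (h : q ∈ (bigOfSign t as).vars) : ∃ a ∈ as, q ∈ a.vars := by
  cases t <;>
  · induction as with
    | nil => exact h.elim
    | cons a as ih =>
      cases as with
      | nil => exact ⟨a, by simp, h⟩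
      | cons b as =>
        rcases h with h | h
        · exact ⟨a, by simp, h⟩
        · obtain ⟨c, hc, hl⟩ := ih h
          exact ⟨c, List.mem_cons_of_mem _ hc, hl⟩

theorem finite_vars (a : Form P N) : a.vars.Finite := by
  induction a <;> simp_all [vars]

/-- All occurrences of `p` in `s a` have the non-critical sign, so every inserted copy of `c` is
rooted at the sign for which it has no critical leaf. -/
theorem NonCritical.subst_flip {p : P} {c a : Form P N} {s : Sign} (ha : a.NonCritical ε s)
    (hc : c.NonCritical ε (ε p).flip) : (Form.subst p c a).NonCritical ε s := by
  intro q hq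
  rcases mem_leaves_subst hq with hq | ⟨u, hu, hq⟩
  · exact ha q hq.1
  · have hne : u ≠ ε p := by rintro rfl; exact ha p hu
    have : u = (ε p).flip := by
      generalize ε p = v at hne
      cases u <;> cases v <;> simp_all [Sign.flip]
    exact hc q (this ▸ hq)

end Form

theorem Ineq.ofSign_injective (s : Sign) (c : Form P N) :
    Function.Injective fun a => Ineq.ofSign s a c := by
  intro a b h
  cases s <;> simpa [Ineq.ofSign] using h

theorem Stage2Step.ackermann {p : P} {s : Sign} {as : List (Form P N)} {S T : Set (Ineq P N)}
    {E : Ineq P N} (hS : S = {J | ∃ a ∈ as, J = Ineq.ofSign s a (.var p)} ∪ T)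
    (has : ∀ a ∈ as, p ∉ a.vars) (hE : p ∉ E.vars) (hT : ∀ J ∈ T, (s, p) ∉ J.leaves) :
    Stage2Step ⟨S, E⟩ ⟨Ineq.subst p (Form.bigOfSign s as) '' T, E⟩ := by
  cases s with
  | plus =>
    exact .right_ackermann p as S T E hS has hE fun J hJ =>
      ⟨fun h => hT J hJ (.inl (Form.mem_leaves_flip.mpr h)), fun h => hT J hJ (.inr h)⟩
  | minus =>
    exact .left_ackermann p as S T E hS has hE fun J hJ =>
      ⟨fun h => hT J hJ (.inl (Form.mem_leaves_flip.mpr h)), fun h => hT J hJ (.inr h)⟩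

/-- The bounding formula has no critical leaf, so the only possible one is the bounded variable
itself. -/
theorem Ineq.IsSolved.critical {J : Ineq P N} (h : J.IsSolved Ω ε) {p : P}
    (hp : (ε p, p) ∈ J.leaves) :
    ∃ a, J = Ineq.ofSign (ε p) a (.var p) ∧ a.NonCritical ε (ε p).flip ∧ ∀ q ∈ a.vars, Ω q p := by
  rcases h with h | ⟨q, a, rfl, ha, hq⟩
  · exact absurd hp (h p)
  · rw [Ineq.leaves_ofSign] at hp
    rcases hp with hp | hp
    · exact absurd hp (ha p)
    · obtain rfl : p = q := (Prod.mk.inj (Set.mem_singleton_iff.mp hp)).2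
      exact ⟨a, rfl, ha, hq⟩

/-- If `p` occurs in a bound of `q`, the variables of `c` enter that bound; they are below `p`,
which is below `q`, so transitivity restores the condition. -/
theorem Ineq.IsSolved.subst (htrans : ∀ p q r, Ω p q → Ω q r → Ω p r) {J : Ineq P N}
    (h : J.IsSolved Ω ε) {p : P} {c : Form P N} (hp : (ε p, p) ∉ J.leaves)
    (hc : c.NonCritical ε (ε p).flip) (hcv : ∀ q ∈ c.vars, Ω q p) :
    (Ineq.subst p c J).IsSolved Ω ε := by
  rcases h with h | ⟨q, a, rfl, ha, hq⟩
  · refine .inl fun q hq => ?_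
    rcases hq with hq | hq
    · exact Form.NonCritical.subst_flip (fun r hr => h r (.inl hr)) hc q hq
    · exact Form.NonCritical.subst_flip (fun r hr => h r (.inr hr)) hc q hq
  · have hqp : q ≠ p := by
      rintro rfl
      rw [Ineq.leaves_ofSign] at hp
      exact hp (.inr rfl)
    refine .inr ⟨q, Form.subst p c a, ?_, ha.subst_flip hc, fun r hr => ?_⟩
    · generalize ε q = s
      cases s <;> simp [Ineq.ofSign, Ineq.subst, Form.subst, hqp]
    · rcases Form.mem_vars_subst hr with hr | ⟨hpa, hr⟩
      · exact hq r hr.1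
      · exact htrans r p q (hcv r hr) (hq p hpa)

theorem exists_pure_of_solved (hirr : ∀ p, ¬ Ω p p)
    (htrans : ∀ p q r, Ω p q → Ω q r → Ω p r) {S : Set (Ineq P N)} (hS : S.Finite)
    (h : ∀ J ∈ S, J.IsSolved Ω ε) {E : Ineq P N} (hE : E.IsPure) (l : List P)
    (hl : ∀ J ∈ S, ∀ q ∈ J.vars, q ∈ l) :
    ∃ T : ASystem P N, Relation.ReflTransGen Stage2Step ⟨S, E⟩ T ∧ T.IsPure := by
  induction l generalizing S with
  | nil =>
    exact ⟨_, .refl, fun J hJ => Set.eq_empty_of_forall_notMem fun q hq => by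
      simpa using hl J hJ q hq, hE⟩
  | cons p l ih =>
    have hfin := hS.preimage (Ineq.ofSign_injective (ε p) (.var p)).injOn
    -- All bounds of `p`, from below or above according to `ε p`. If there are none, `p` is replaced
    -- by `bot` or `top`.
    set as := hfin.toFinset.toList with has
    have mem_as : ∀ {a}, a ∈ as ↔ Ineq.ofSign (ε p) a (.var p) ∈ S := by simp [has]
    have hbound : ∀ a ∈ as, a.NonCritical ε (ε p).flip ∧ ∀ q ∈ a.vars, Ω q p := by
      intro a ha
      obtain ⟨b, hb, hb'⟩ := (h _ (mem_as.mp ha)).critical (p := p)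
        (by rw [Ineq.leaves_ofSign]; exact .inr rfl)
      rwa [Ineq.ofSign_injective (ε p) (.var p) hb]
    have hpas : ∀ a ∈ as, p ∉ a.vars := fun a ha hp => hirr p ((hbound a ha).2 p hp)
    set c := Form.bigOfSign (ε p) as with hc
    have hcn : c.NonCritical ε (ε p).flip := by
      intro q hq
      obtain ⟨a, ha, hq⟩ := Form.exists_mem_leaves_of_bigOfSign hq
      exact (hbound a ha).1 q hq
    have hcv : ∀ q ∈ c.vars, ∃ a ∈ as, q ∈ a.vars := fun q hq =>
      Form.exists_mem_vars_of_bigOfSign hq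
    have hcΩ : ∀ q ∈ c.vars, Ω q p := by
      intro q hq
      obtain ⟨a, ha, hq⟩ := hcv q hq
      exact (hbound a ha).2 q hq
    have hcl : ∀ q ∈ c.vars, q ∈ p :: l := by
      intro q hq
      obtain ⟨a, ha, hq⟩ := hcv q hq
      exact hl _ (mem_as.mp ha) q (by rw [Ineq.vars_ofSign]; exact .inl hq)
    have step : Stage2Step ⟨S, E⟩
        ⟨Ineq.subst p c '' {J ∈ S | (ε p, p) ∉ J.leaves}, E⟩ := by
      refine .ackermann ?_ hpas (by rw [hE]; exact Set.notMem_empty p) fun J hJ => hJ.2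
      ext J
      constructor
      · intro hJ
        by_cases hp : (ε p, p) ∈ J.leaves
        · obtain ⟨a, rfl, -⟩ := (h J hJ).critical hp
          exact .inl ⟨a, mem_as.mpr hJ, rfl⟩
        · exact .inr ⟨hJ, hp⟩
      · rintro (⟨a, ha, rfl⟩ | hJ)
        · exact mem_as.mp ha
        · exact hJ.1
    obtain ⟨T, hT, hT'⟩ := ih ((hS.subset (Set.sep_subset _ _)).image _)
      (by
        rintro _ ⟨J, hJ, rfl⟩
        exact (h J hJ.1).subst htrans hJ.2 hcn hcΩ)
      (by
        rintro _ ⟨J, hJ, rfl⟩ q hq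
        have key : q ∈ p :: l ∧ q ≠ p := by
          -- By irreflexivity the substituted formula does not bring `p` back, so the list of
          -- remaining variables shrinks.
          have hpc : ∀ r ∈ c.vars, r ≠ p := by rintro r hr rfl; exact hirr r (hcΩ r hr)
          rcases hq with hq | hq
          · rcases Form.mem_vars_subst hq with hq | hq
            · exact ⟨hl J hJ.1 q (.inl hq.1), hq.2⟩
            · exact ⟨hcl q hq.2, hpc q hq.2⟩
          · rcases Form.mem_vars_subst hq with hq | hq
            · exact ⟨hl J hJ.1 q (.inr hq.1), hq.2⟩
            · exact ⟨hcl q hq.2, hpc q hq.2⟩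
        exact (List.mem_cons.mp key.1).resolve_left key.2)
    exact ⟨T, .head step hT, hT'⟩

/-! ### Success -/

theorem exists_pure_of_definite [Infinite N] (hirr : ∀ p, ¬ Ω p p)
    (htrans : ∀ p q r, Ω p q → Ω q r → Ω p r) {I : Ineq P N} (hI : I.IsBasic)
    (hl : I.lhs.Definite Ω ε .plus) (hr : I.rhs.Definite Ω ε .minus) :
    ∃ T : ASystem P N, Relation.ReflTransGen Stage2Step ⟨∅, I⟩ T ∧ T.IsPure := by
  obtain ⟨S₁, E, hS₁, hA, hE, hI₁⟩ := Ineq.exists_approximation hI hl hr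
  obtain ⟨S₂, h₁₂, hS₂, hs⟩ := exists_solved hS₁ (fun J hJ => (hA J hJ).isSolvable) E
  have hfin : (⋃ J ∈ S₂, J.vars).Finite :=
    hS₂.biUnion fun J _ => J.lhs.finite_vars.union J.rhs.finite_vars
  obtain ⟨T, h₂, hT⟩ := exists_pure_of_solved hirr htrans hS₂ hs hE hfin.toFinset.toList
    fun J hJ q hq => by simpa using ⟨J, hJ, hq⟩
  exact ⟨T, hI₁.trans (h₁₂.trans h₂), hT⟩

theorem Ineq.IsInductive.succeeds [Infinite N] (hirr : ∀ p, ¬ Ω p p)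
    (htrans : ∀ p q r, Ω p q → Ω q r → Ω p r) {I : Ineq P N} (hI : I.IsBasic)
    (h : I.IsInductive Ω ε) : Succeeds I := by
  refine ⟨exists_stage1Result I, fun X hX => ?_⟩
  obtain ⟨hfin, hX'⟩ := hX.finite_and_isBasicInd ⟨hI, h.1.ind, h.2.ind⟩
  refine ⟨hfin, fun J hJ => ?_⟩
  obtain ⟨hl, hr⟩ := (hX' J hJ).definite (hX.2 J hJ)
  exact exists_pure_of_definite hirr htrans (hX' J hJ).1 hl hr

end

end ALBA

theorem mainTheorem2 {P : Type*} {N : Type*} [Infinite N]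
    (I : ALBA.Ineq P N) (hI : I.IsBasic) :
    (∀ (Ω : P → P → Prop) (ε : P → ALBA.Sign),
      (∀ p, ¬ Ω p p) → (∀ p q r, Ω p q → Ω q r → Ω p r) →
      I.IsInductive Ω ε → ALBA.Succeeds I) ∧
    (∀ ε : P → ALBA.Sign, I.IsSahlqvist ε → ALBA.Succeeds I) :=
  ⟨fun _ _ hirr htrans h => h.succeeds hirr htrans hI, fun _ h =>
    ALBA.Ineq.IsInductive.succeeds (Ω := fun _ _ => False) (fun _ h => h) (fun _ _ _ h _ => h) hI
      ⟨h.1.isInductive, h.2.isInductive⟩⟩
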